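/- Let $n\in\mathbb N$ and let $\mathcal R\subset\mathbb C^n$ be a bounded Reinhardt domain, i.e. a nonempty, bounded, connected open set such that $(z_1,\dots,z_n)\in\mathcal R$ implies $(e^{i\theta_1}z_1,\dots,e^{i\theta_n}z_n)\in\mathcal R$ for all $\theta\in\mathbb R^n$. Let $1<p<\infty$, and let $f\in A^p(\mathcal R)$, i.e. $f$ is holomorphic on $\mathcal R$ and $\|f\|_p=\left(\int_{\mathcal R}|f|^p\,dV\right)^{1/p}<\infty$, where $dV$ is Lebesgue measure. Then there is a unique family of coefficients $(a_\alpha)_{\alpha\in\mathbb Z^n}$ such that $f$ has the Laurent expansion $$f(z)=\sum_{\alpha\in\mathbb Z^n}a_\alpha z^\alpha ,$$ converging (unconditionally and) uniformly on compact subsets of $\mathcal R$, where $a_\alpha=0$ whenever $\alpha_j<0$ for some $j$ for which $\mathcal R$ contains a point with $z_j=0$. For $N\in\mathbb N$ let $$S_Nf(z)=\sum_{|\alpha|_\infty\le N}a_\alpha z^\alpha,\qquad |\alpha|_\infty=\max_{1\le j\le n}|\alpha_j|,$$ be the square partial sums of this expansion. Then $S_Nf\in A^p(\mathcal R)$ for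 every $N$, and $$\|S_Nf-f\|_{p}\longrightarrow 0\qquad\text{as }N\to\infty .$$ -/

import Mathlib

open MeasureTheory Filter Topology
open scoped ENNReal

namespace ReinhardtLaurent

/-- A set in `ℂⁿ` is Reinhardt if it is invariant under all rotations of the coordinates. -/
def IsReinhardt {n : ℕ} (R : Set (Fin n → ℂ)) : Prop :=
  ∀ z ∈ R, ∀ θ : Fin n → ℝ, (fun j => Complex.exp (θ j * Complex.I) * z j) ∈ R

/-- A bounded Reinhardt domain: a nonempty, open, connected, bounded Reinhardt set
(`IsConnected` includes nonemptiness). -/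
structure IsBoundedReinhardtDomain {n : ℕ} (R : Set (Fin n → ℂ)) : Prop where
  isOpen : IsOpen R
  isConnected : IsConnected R
  isBounded : Bornology.IsBounded R
  isReinhardt : IsReinhardt R

/-- `f` belongs to the Bergman space `A^p(R)`: it is holomorphic on `R` and lies in `L^p(R)` with
respect to Lebesgue measure. -/
structure MemBergman {n : ℕ} (R : Set (Fin n → ℂ)) (p : ℝ≥0∞) (f : (Fin n → ℂ) → ℂ) : Prop where
  holomorphic : DifferentiableOn ℂ f R
  memLp : MemLp f p (volume.restrict R)

/-- The monomial `e_α(z) = z₁^{α₁} ⋯ zₙ^{αₙ}` with integer exponents. -/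
noncomputable def laurentMonomial {n : ℕ} (α : Fin n → ℤ) (z : Fin n → ℂ) : ℂ :=
  ∏ j, z j ^ α j

/-- `∑ a_α z^α`, summed over `α ∈ ℤⁿ`, is a Laurent expansion of `f` on `R`: every monomial that
occurs is well defined on `R` (no negative power of a coordinate that vanishes somewhere on `R`),
and the series converges (unconditionally) to `f`, uniformly on every compact subset of `R`. -/
structure IsLaurentExpansion {n : ℕ} (R : Set (Fin n → ℂ)) (f : (Fin n → ℂ) → ℂ)
    (a : (Fin n → ℤ) → ℂ) : Prop where
  wellDefined : ∀ α, a α ≠ 0 → ∀ z ∈ R, ∀ j, α j < 0 → z j ≠ 0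
  hasSum : ∀ K ⊆ R, IsCompact K → HasSumUniformlyOn (fun α z => a α * laurentMonomial α z) f K

/-- The multi-indices `α ∈ ℤⁿ` with `|α|_∞ ≤ N`. -/
noncomputable def squareIndices (n N : ℕ) : Finset (Fin n → ℤ) :=
  Fintype.piFinset fun _ => Finset.Icc (-(N : ℤ)) (N : ℤ)

theorem mem_squareIndices {n N : ℕ} {α : Fin n → ℤ} :
    α ∈ squareIndices n N ↔ ∀ j, |α j| ≤ (N : ℤ) := by
  simp [squareIndices, abs_le]

/-- The square partial sum `∑_{|α|_∞ ≤ N} a_α z^α`. -/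
noncomputable def squarePartialSum {n : ℕ} (a : (Fin n → ℤ) → ℂ) (N : ℕ) (z : Fin n → ℂ) : ℂ :=
  ∑ α ∈ squareIndices n N, a α * laurentMonomial α z

end ReinhardtLaurent

namespace ReinhardtLaurent

open AddCircle

/-! On each torus orbit inside the domain, the Laurent series of `f` is a multiple Fourier series,
so square partial sums are a product of one-dimensional partial sum operators, one per coordinate.
M. Riesz's theorem bounds these on `L^p` of the circle uniformly in `N`. Rotations preserve volume
and the domain, so integrating p-th powers over circles carries the bound to the domain
(`exists_eLpNorm_truncate_le`).

Riesz's theorem comes from a pointwise inequality and the mean value property for `1 < p ≤ 2`, and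
from duality for `p > 2` (`exists_eLpNorm_filter_abs_le`). It passes to absolutely convergent series
by continuity.

The expansion is built from torus Fourier coefficients. They transform under rotation like monomials
and are holomorphic along lines, hence are multiples of monomials (`exists_torusCoeff_eq`).
Comparing radii gives geometric bounds, hence normal convergence (`exists_summable_bound_near`).
Orthogonality gives uniqueness.

For norm convergence in one coordinate, the error on each circle tends to zero because the series
converges absolutely there. The Riesz bound supplies an integrable majorant, so dominated
convergence applies (`tendsto_eLpNorm_truncateError`). Induction on the set of truncated coordinates
does the rest (`tendsto_eLpNorm_truncateOn_sub`). -/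

/-! ### Conjugate function estimates on the circle, `1 < p ≤ 2`. -/

/-- The pointwise inequality behind M. Riesz's theorem. -/
theorem exists_norm_rpow_le_sub_re_cpow {p : ℝ} (hp1 : 1 < p) (hp2 : p ≤ 2) :
    ∃ A B : ℝ, 0 ≤ A ∧ 0 ≤ B ∧ ∀ w : ℂ, 0 < w.re →
      ‖w‖ ^ p ≤ A * w.re ^ p - B * (w ^ (p : ℂ)).re := by
  have hπ := Real.pi_pos
  have hp0 : 0 < p := by linarith
  -- In the sector `|arg w| ≤ γ` the real part is comparable to `‖w‖`. Outside it `p |arg w|` lies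
  -- between `γ p > π / 2` and `π` (here `p ≤ 2` enters), so `Re w ^ p` is at most a negative
  -- multiple of `‖w‖ ^ p`.
  obtain ⟨γ, hγ1, hγ2⟩ : ∃ γ, Real.pi / 2 / p < γ ∧ γ < Real.pi / 2 :=
    exists_between (div_lt_self (by positivity) hp1)
  have hγ0 : 0 < γ := lt_trans (by positivity) hγ1
  rw [div_lt_iff₀ hp0] at hγ1
  have hγp : γ * p ≤ Real.pi := by nlinarith
  have hcos : 0 < Real.cos γ := Real.cos_pos_of_mem_Ioo ⟨by linarith, hγ2⟩
  have hcosp : Real.cos (γ * p) < 0 :=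
    Real.cos_neg_of_pi_div_two_lt_of_lt hγ1 (by linarith)
  set B : ℝ := (-Real.cos (γ * p))⁻¹ with hB
  have hB0 : 0 < B := inv_pos.2 (by linarith)
  -- The factor `1 + B` absorbs the possibly positive `B * Re w ^ p` inside the sector.
  refine ⟨(1 + B) * ((Real.cos γ) ^ p)⁻¹, B, by positivity, hB0.le, fun w hw => ?_⟩
  have harg := Complex.abs_arg_lt_pi_div_two_iff.2 (Or.inl hw)
  have hn : 0 ≤ ‖w‖ ^ p := by positivity
  rw [Complex.cpow_ofReal_re, ← Real.cos_abs (w.arg * p), abs_mul, abs_of_pos hp0]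
  have hre : w.re = ‖w‖ * Real.cos |w.arg| := by rw [Real.cos_abs, Complex.norm_mul_cos_arg]
  rcases le_total |w.arg| γ with h | h
  · have h1 : Real.cos γ ≤ Real.cos |w.arg| :=
      Real.cos_le_cos_of_nonneg_of_le_pi (abs_nonneg _) (by linarith) h
    have h2 : ‖w‖ ^ p * Real.cos γ ^ p ≤ w.re ^ p := by
      rw [← Real.mul_rpow (norm_nonneg _) hcos.le, hre]
      gcongr
    have h3 : ‖w‖ ^ p ≤ (Real.cos γ ^ p)⁻¹ * w.re ^ p := by
      rw [← div_eq_inv_mul, le_div_iff₀ (by positivity)]; exact h2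
    have h4 : ‖w‖ ^ p * Real.cos (|w.arg| * p) ≤ ‖w‖ ^ p :=
      mul_le_of_le_one_right hn (Real.cos_le_one _)
    nlinarith
  · have h1 : Real.cos (|w.arg| * p) ≤ Real.cos (γ * p) :=
      Real.cos_le_cos_of_nonneg_of_le_pi (by positivity) (by nlinarith) (by gcongr)
    have h2 : 1 ≤ B * -Real.cos (|w.arg| * p) := by
      rw [hB, inv_mul_eq_div, le_div_iff₀ (by linarith)]; linarith
    have h3 : 0 ≤ (1 + B) * ((Real.cos γ) ^ p)⁻¹ * w.re ^ p := by positivity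
    nlinarith

/-- Mean value property over the unit additive circle. -/
theorem integral_comp_fourier_one {H : ℂ → ℂ} (hH : DiffContOnCl ℂ H (Metric.ball 0 1)) :
    ∫ t : UnitAddCircle, H (fourier 1 t) ∂haarAddCircle = H 0 := by
  have h1 := DiffContOnCl.circleAverage (f := H) (c := 0) (R := 1) (by simpa using hH)
  rw [← h1, Real.circleAverage_def]
  have h2 := UnitAddCircle.intervalIntegral_preimage 0 (fun t => H (fourier 1 t))
  have h3 : (volume : Measure UnitAddCircle) = haarAddCircle := by
    rw [AddCircle.volume_eq_smul_haarAddCircle]; simp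
  rw [h3, zero_add] at h2
  rw [← h2]
  have h4 := intervalIntegral.integral_comp_mul_left (a := 0) (b := 1)
    (fun θ => H (circleMap 0 1 θ)) (c := 2 * Real.pi) (by positivity)
  simp only [mul_zero, mul_one] at h4
  rw [← h4]
  refine intervalIntegral.integral_congr fun x _ => ?_
  simp only [circleMap, fourier_coe_apply]
  congr 1
  push_cast
  simp
  ring_nf

/-- Maximum principle for `exp (-F)`, whose modulus is `exp (-Re F)`; compactness of the circle
supplies a positive minimum of `Re F`. This keeps `F` in the domain of the principal power on the
closed disc. -/
theorem re_pos_of_re_pos_on_circle {F : ℂ → ℂ} (hF : Differentiable ℂ F)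
    (h : ∀ t : UnitAddCircle, 0 < (F (fourier 1 t)).re) {z : ℂ}
    (hz : z ∈ Metric.closedBall (0 : ℂ) 1) : 0 < (F z).re := by
  obtain ⟨t₀, -, ht₀⟩ := isCompact_univ.exists_isMinOn (s := (Set.univ : Set UnitAddCircle))
    Set.univ_nonempty (f := fun t => (F (fourier 1 t)).re)
    (Complex.continuous_re.comp (hF.continuous.comp (fourier 1).continuous)).continuousOn
  have hfr : ∀ w ∈ frontier (Metric.ball (0 : ℂ) 1),
      ‖Complex.exp (-F w)‖ ≤ Real.exp (-(F (fourier 1 t₀)).re) := by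
    intro w hw
    rw [frontier_ball _ one_ne_zero, mem_sphere_zero_iff_norm] at hw
    obtain ⟨t, ht⟩ : ∃ t : UnitAddCircle, (fourier 1 t : ℂ) = w := by
      refine ⟨((AddCircle.homeomorphCircle one_ne_zero).symm ⟨w, by simpa [Submonoid.unitSphere] using hw⟩), ?_⟩
      rw [fourier_one]
      have := (AddCircle.homeomorphCircle one_ne_zero).apply_symm_apply
        (⟨w, by simpa [Submonoid.unitSphere] using hw⟩ : Circle)
      rw [AddCircle.homeomorphCircle_apply] at this
      rw [this]
    have := ht₀ (Set.mem_univ t)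
    rw [Complex.norm_exp, ← ht]
    simpa using this
  have := Complex.norm_le_of_forall_mem_frontier_norm_le Metric.isBounded_ball
    (f := fun w => Complex.exp (-F w)) (hF.neg.cexp).diffContOnCl hfr
    (z := z) (by rwa [closure_ball _ one_ne_zero])
  rw [Complex.norm_exp, Real.exp_le_exp] at this
  have h0 := h t₀
  simp only [Complex.neg_re] at this
  linarith

theorem eLpNorm_rpow_toReal {X E : Type*} [MeasurableSpace X] [NormedAddCommGroup E]
    {μ : Measure X} {p : ℝ} (hp : 0 < p) {f : X → E} (hf : MemLp f (ENNReal.ofReal p) μ) :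
    (eLpNorm f (ENNReal.ofReal p) μ) ^ p = ENNReal.ofReal (∫ x, ‖f x‖ ^ p ∂μ) := by
  rw [hf.eLpNorm_eq_integral_rpow_norm (by simpa using hp) ENNReal.ofReal_ne_top,
    ENNReal.toReal_ofReal hp.le, ENNReal.ofReal_rpow_of_nonneg (by positivity) hp.le,
    ← Real.rpow_mul (by positivity), inv_mul_cancel₀ hp.ne', Real.rpow_one]

theorem memLp_haar_of_continuous {E : Type*} [NormedAddCommGroup E] {f : UnitAddCircle → E}
    (hf : Continuous f) (p : ℝ≥0∞) : MemLp f p (haarAddCircle : Measure UnitAddCircle) := by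
  obtain ⟨C, hC⟩ := isCompact_univ.exists_bound_of_continuousOn hf.continuousOn
  exact MemLp.of_bound (hf.aestronglyMeasurable_of_compactSpace) C
    (Eventually.of_forall fun x => hC x (Set.mem_univ x))

theorem integrable_haar_of_continuous {E : Type*} [NormedAddCommGroup E] {f : UnitAddCircle → E}
    (hf : Continuous f) : Integrable f (haarAddCircle : Measure UnitAddCircle) :=
  memLp_one_iff_integrable.1 (memLp_haar_of_continuous hf 1)

/-- An entire function with positive real part on the unit circle, and real at the origin, is
controlled in `L^p` of the circle by its real part. -/
theorem exists_eLpNorm_le_re_of_pos {p : ℝ} (hp1 : 1 < p) (hp2 : p ≤ 2) :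
    ∃ A : ℝ, 0 ≤ A ∧ ∀ F : ℂ → ℂ, Differentiable ℂ F → (F 0).im = 0 →
      (∀ t : UnitAddCircle, 0 < (F (fourier 1 t)).re) →
      eLpNorm (fun t : UnitAddCircle => F (fourier 1 t)) (ENNReal.ofReal p) haarAddCircle ≤
        ENNReal.ofReal A * eLpNorm (fun t : UnitAddCircle => (F (fourier 1 t)).re)
          (ENNReal.ofReal p) haarAddCircle := by
  obtain ⟨A, B, hA, hB, hAB⟩ := exists_norm_rpow_le_sub_re_cpow hp1 hp2
  have hp0 : 0 < p := by linarith
  refine ⟨A ^ p⁻¹, by positivity, fun F hF h0 hpos => ?_⟩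
  have hc : Continuous fun t : UnitAddCircle => F (fourier 1 t) :=
    hF.continuous.comp (fourier 1).continuous
  have hcr : Continuous fun t : UnitAddCircle => (F (fourier 1 t)).re :=
    Complex.continuous_re.comp hc
  have hcp : Continuous fun t : UnitAddCircle => F (fourier 1 t) ^ (p : ℂ) :=
    hc.cpow continuous_const fun t => Or.inl (hpos t)
  have hdiff : DiffContOnCl ℂ (fun z => F z ^ (p : ℂ)) (Metric.ball 0 1) := by
    have : DifferentiableOn ℂ (fun z => F z ^ (p : ℂ)) (closure (Metric.ball 0 1)) := by
      intro z hz
      rw [closure_ball _ one_ne_zero] at hz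
      exact ((hF z).cpow (differentiableAt_const _)
        (Or.inl (re_pos_of_re_pos_on_circle hF hpos hz))).differentiableWithinAt
    exact this.diffContOnCl
  have hmean := integral_comp_fourier_one hdiff
  have hF0 : 0 < (F 0).re := re_pos_of_re_pos_on_circle hF hpos (by simp)
  -- The mean of `Re F ^ p` over the circle is its value at the origin, where `F` is a positive
  -- real; so the `B` term has a favourable sign and can be dropped.
  have hF0' : 0 ≤ (F 0 ^ (p : ℂ)).re := by
    have : F 0 = ((F 0).re : ℂ) := Complex.ext rfl (by simp [h0])
    rw [this, ← Complex.ofReal_cpow hF0.le, Complex.ofReal_re]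
    positivity
  have hmean' : ∫ t : UnitAddCircle, (F (fourier 1 t) ^ (p : ℂ)).re ∂haarAddCircle
      = (F 0 ^ (p : ℂ)).re := by
    rw [← hmean]
    exact integral_re (𝕜 := ℂ) (integrable_haar_of_continuous hcp)
  have hcr' : Continuous fun t : UnitAddCircle => (F (fourier 1 t)).re ^ p :=
    hcr.rpow_const fun t => Or.inr hp0.le
  have hint : ∫ t : UnitAddCircle, ‖F (fourier 1 t)‖ ^ p ∂haarAddCircle ≤
      A * ∫ t : UnitAddCircle, ‖(F (fourier 1 t)).re‖ ^ p ∂haarAddCircle := by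
    calc ∫ t : UnitAddCircle, ‖F (fourier 1 t)‖ ^ p ∂haarAddCircle
        ≤ ∫ t : UnitAddCircle, (A * (F (fourier 1 t)).re ^ p
            - B * (F (fourier 1 t) ^ (p : ℂ)).re) ∂haarAddCircle := by
          refine integral_mono (integrable_haar_of_continuous
            (hc.norm.rpow_const fun t => Or.inr hp0.le))
            (integrable_haar_of_continuous (by fun_prop)) fun t => hAB _ (hpos t)
      _ = A * ∫ t : UnitAddCircle, (F (fourier 1 t)).re ^ p ∂haarAddCircle
            - B * (F 0 ^ (p : ℂ)).re := by
          rw [integral_sub (integrable_haar_of_continuous (by fun_prop))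
            (integrable_haar_of_continuous (by fun_prop)), integral_const_mul,
            integral_const_mul, hmean']
      _ ≤ A * ∫ t : UnitAddCircle, (F (fourier 1 t)).re ^ p ∂haarAddCircle := by
          have := mul_nonneg hB hF0'
          linarith
      _ = _ := by
          congr 2
          ext t
          rw [Real.norm_of_nonneg (hpos t).le]
  rw [← ENNReal.rpow_le_rpow_iff hp0, ENNReal.mul_rpow_of_nonneg _ _ hp0.le,
    eLpNorm_rpow_toReal hp0 (memLp_haar_of_continuous hc _),
    eLpNorm_rpow_toReal hp0 (memLp_haar_of_continuous hcr _),
    ENNReal.ofReal_rpow_of_nonneg (by positivity) hp0.le, ← Real.rpow_mul hA,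
    inv_mul_cancel₀ hp0.ne', Real.rpow_one, ← ENNReal.ofReal_mul hA]
  exact ENNReal.ofReal_le_ofReal hint

theorem fourier_natCast (n : ℕ) (t : UnitAddCircle) :
    fourier (n : ℤ) t = (fourier 1 t : ℂ) ^ n := by
  induction n with
  | zero => simp
  | succ n ih => rw [pow_succ, ← ih, ← fourier_add]; simp

/-- Continuous real functions on the circle are uniformly approximated by real parts of entire
functions that are real at the origin. -/
theorem exists_entire_re_approx {g : UnitAddCircle → ℝ} (hg : Continuous g) {ε : ℝ} (hε : 0 < ε) :
    ∃ K : ℂ → ℂ, Differentiable ℂ K ∧ (K 0).im = 0 ∧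
      ∀ t : UnitAddCircle, |g t - (K (fourier 1 t)).re| < ε := by
  -- A negative frequency is the conjugate of a power of `z`, and conjugation does not change the
  -- real part.
  have hfour : ∀ n : ℤ, ∀ a : ℂ, ∃ K : ℂ → ℂ, Differentiable ℂ K ∧
      ∀ t : UnitAddCircle, (a * fourier n t).re = (K (fourier 1 t)).re := by
    intro n a
    obtain ⟨m, rfl | rfl⟩ := n.eq_nat_or_neg
    · refine ⟨fun z => a * z ^ m, by fun_prop, fun t => ?_⟩
      rw [fourier_natCast]
    · refine ⟨fun z => (starRingEnd ℂ) a * z ^ m, by fun_prop, fun t => ?_⟩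
      rw [fourier_neg, fourier_natCast, ← Complex.conj_re, map_mul, Complex.conj_conj]
  -- The multiplier `a` is quantified because taking real parts is not complex linear: it lets the
  -- induction pass through scalar multiples.
  have hspan : ∀ f ∈ Submodule.span ℂ (Set.range (@fourier (1 : ℝ))), ∀ a : ℂ,
      ∃ K : ℂ → ℂ, Differentiable ℂ K ∧
        ∀ t : UnitAddCircle, (a * f t).re = (K (fourier 1 t)).re := by
    intro f hf
    induction hf using Submodule.span_induction with
    | mem x h => obtain ⟨n, rfl⟩ := h; exact hfour n
    | zero => exact fun a => ⟨0, differentiable_const 0, by simp⟩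
    | add x y _ _ hx hy =>
      intro a
      obtain ⟨K, hK, hK'⟩ := hx a
      obtain ⟨M, hM, hM'⟩ := hy a
      refine ⟨fun z => K z + M z, hK.add hM, fun t => ?_⟩
      simp only [ContinuousMap.add_apply, mul_add, Complex.add_re, hK', hM']
    | smul b x _ hx =>
      intro a
      obtain ⟨K, hK, hK'⟩ := hx (a * b)
      refine ⟨K, hK, fun t => ?_⟩
      rw [← hK']; simp [mul_assoc]
  let G : C(UnitAddCircle, ℂ) := ⟨fun t => (g t : ℂ), by fun_prop⟩
  have hG : G ∈ closure (Submodule.span ℂ (Set.range (@fourier (1 : ℝ))) : Set C(UnitAddCircle, ℂ)) := by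
    rw [← Submodule.topologicalClosure_coe, span_fourier_closure_eq_top]
    trivial
  obtain ⟨f, hf, hfG⟩ := Metric.mem_closure_iff.1 hG ε hε
  obtain ⟨K, hK, hK'⟩ := hspan f hf 1
  refine ⟨fun z => K z - ((K 0).im : ℂ) * Complex.I, by fun_prop, by simp, fun t => ?_⟩
  have h1 : ‖G t - f t‖ < ε := by
    rw [← dist_eq_norm]; exact (ContinuousMap.dist_apply_le_dist t).trans_lt hfG
  have h2 := (Complex.abs_re_le_norm (G t - f t)).trans_lt h1
  have h3 := hK' t
  rw [one_mul] at h3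
  simp only [Complex.sub_re, Complex.mul_re, Complex.ofReal_re, Complex.I_re, mul_zero,
    Complex.ofReal_im, Complex.I_im] at h2 ⊢
  rw [← h3]
  simpa [G] using h2

/-- An entire function that is real at the origin is controlled in `L^p` of the circle by its real
part. -/
theorem exists_eLpNorm_le_re_of_im_zero {p : ℝ} (hp1 : 1 < p) (hp2 : p ≤ 2) :
    ∃ A : ℝ, 0 ≤ A ∧ ∀ F : ℂ → ℂ, Differentiable ℂ F → (F 0).im = 0 →
      eLpNorm (fun t : UnitAddCircle => F (fourier 1 t)) (ENNReal.ofReal p) haarAddCircle ≤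
        ENNReal.ofReal A * eLpNorm (fun t : UnitAddCircle => (F (fourier 1 t)).re)
          (ENNReal.ofReal p) haarAddCircle := by
  obtain ⟨A, hA, h⟩ := exists_eLpNorm_le_re_of_pos hp1 hp2
  have hp1' : (1 : ℝ≥0∞) ≤ ENNReal.ofReal p := by simpa using hp1.le
  refine ⟨2 * A, by positivity, fun F hF h0 => ?_⟩
  set P := ENNReal.ofReal p
  set μ : Measure UnitAddCircle := haarAddCircle
  set N : ℝ≥0∞ := eLpNorm (fun t : UnitAddCircle => (F (fourier 1 t)).re) P μ with hN
  have hc : Continuous fun t : UnitAddCircle => F (fourier 1 t) :=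
    hF.continuous.comp (fourier 1).continuous
  have hcr : Continuous fun t : UnitAddCircle => (F (fourier 1 t)).re :=
    Complex.continuous_re.comp hc
  suffices key : ∀ ε : ℝ, 0 < ε → eLpNorm (fun t : UnitAddCircle => F (fourier 1 t)) P μ ≤
      ENNReal.ofReal A * (2 * N + ENNReal.ofReal (3 * ε)) by
    have ht : Tendsto (fun ε : ℝ => ENNReal.ofReal A * (2 * N + ENNReal.ofReal (3 * ε)))
        (𝓝[>] 0) (𝓝 (ENNReal.ofReal A * (2 * N + ENNReal.ofReal (3 * 0)))) := by
      refine ENNReal.Tendsto.const_mul (Tendsto.const_add _ ?_) (Or.inr ENNReal.ofReal_ne_top)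
      refine (ENNReal.continuous_ofReal.comp (continuous_const_mul 3)).continuousAt.tendsto.mono_left
        nhdsWithin_le_nhds
    have := ge_of_tendsto ht (eventually_nhdsWithin_of_forall fun ε hε => key ε hε)
    refine this.trans (le_of_eq ?_)
    rw [mul_zero, ENNReal.ofReal_zero, add_zero, ENNReal.ofReal_mul zero_le_two,
      ENNReal.ofReal_ofNat]
    ring
  intro ε hε
  -- With `Re K` within `ε` of `|Re F| + 2ε`, both `K + F` and `K - F` have real part between `ε`
  -- and `2 |Re F| + 3ε`, so the positive case applies to each. Half their difference is `F`.
  obtain ⟨K, hK, hK0, hKε⟩ := exists_entire_re_approx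
    (g := fun t => |(F (fourier 1 t)).re| + 2 * ε) (by fun_prop) hε
  have hKc : Continuous fun t : UnitAddCircle => K (fourier 1 t) :=
    hK.continuous.comp (fourier 1).continuous
  have hb : ∀ G : ℂ → ℂ, Differentiable ℂ G → (G 0).im = 0 →
      (∀ t : UnitAddCircle, |(G (fourier 1 t)).re| = |(F (fourier 1 t)).re|) →
      eLpNorm (fun t : UnitAddCircle => K (fourier 1 t) + G (fourier 1 t)) P μ ≤
        ENNReal.ofReal A * (2 * N + ENNReal.ofReal (3 * ε)) := by
    intro G hG hG0 hGF
    refine (h (fun z => K z + G z) (hK.add hG) (by simp [hK0, hG0]) fun t => ?_).trans ?_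
    · have h1 := (abs_lt.1 (hKε t)).2
      have h2 := neg_abs_le (G (fourier 1 t)).re
      rw [hGF] at h2
      simp only [Complex.add_re]
      linarith
    · gcongr
      calc eLpNorm (fun t : UnitAddCircle => (K (fourier 1 t) + G (fourier 1 t)).re) P μ
          ≤ eLpNorm (fun t : UnitAddCircle => (2 : ℝ) * |(F (fourier 1 t)).re| + 3 * ε) P μ := by
            refine eLpNorm_mono_real fun t => ?_
            have h1 := (abs_lt.1 (hKε t))
            have h2 := neg_abs_le (G (fourier 1 t)).re
            have h3 := le_abs_self (G (fourier 1 t)).re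
            rw [hGF] at h2 h3
            rw [Real.norm_eq_abs, Complex.add_re, abs_le]
            constructor <;> linarith [h1.1, h1.2, abs_nonneg (F (fourier 1 t)).re]
        _ ≤ eLpNorm (fun t : UnitAddCircle => (2 : ℝ) * |(F (fourier 1 t)).re|) P μ +
              eLpNorm (fun _ : UnitAddCircle => 3 * ε) P μ :=
            eLpNorm_add_le (Continuous.aestronglyMeasurable_of_compactSpace (by fun_prop))
              aestronglyMeasurable_const hp1'
        _ ≤ 2 * N + ENNReal.ofReal (3 * ε) := by
            gcongr
            · have := eLpNorm_const_smul (2 : ℝ) (fun t : UnitAddCircle => |(F (fourier 1 t)).re|) P μ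
              have h5 : (fun t : UnitAddCircle => (2 : ℝ) * |(F (fourier 1 t)).re|) =
                (2 : ℝ) • (fun t : UnitAddCircle => |(F (fourier 1 t)).re|) := by
                ext; simp
              rw [h5, this]
              have h6 : eLpNorm (fun t : UnitAddCircle => |(F (fourier 1 t)).re|) P μ = N :=
                eLpNorm_norm (fun t : UnitAddCircle => (F (fourier 1 t)).re)
              rw [h6, Real.enorm_eq_ofReal zero_le_two, ENNReal.ofReal_ofNat]
            · rw [eLpNorm_const _ (by positivity) (NeZero.ne μ)]
              simp only [measure_univ, ENNReal.one_rpow, mul_one]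
              rw [Real.enorm_eq_ofReal (by positivity)]
  have h1 := hb F hF h0 fun t => rfl
  have h2 := hb (fun z => -F z) hF.neg (by simp [h0]) fun t => by simp
  have h3 : (fun t : UnitAddCircle => F (fourier 1 t)) =
      (2⁻¹ : ℝ) • ((fun t : UnitAddCircle => K (fourier 1 t) + F (fourier 1 t)) -
        (fun t : UnitAddCircle => K (fourier 1 t) + -F (fourier 1 t))) := by
    ext t; simp; ring
  rw [h3, eLpNorm_const_smul]
  have h4 := (eLpNorm_sub_le (hKc.add hc).aestronglyMeasurable_of_compactSpace
    (hKc.add hc.neg).aestronglyMeasurable_of_compactSpace hp1').trans (add_le_add h1 h2)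
  refine (mul_le_mul_right h4 _).trans (le_of_eq ?_)
  rw [← two_mul, ← mul_assoc, Real.enorm_eq_ofReal (by positivity),
    ENNReal.ofReal_inv_of_pos zero_lt_two, ENNReal.ofReal_ofNat,
    ENNReal.inv_mul_cancel two_ne_zero ENNReal.ofNat_ne_top, one_mul]

/-! ### Analytic projection and partial sums of trigonometric polynomials, `1 < p ≤ 2`. -/

/-- The trigonometric polynomial `∑ c_k e^{2πikt}` on the unit additive circle. -/
noncomputable def trigPoly : (ℤ →₀ ℂ) →ₗ[ℂ] C(UnitAddCircle, ℂ) :=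
  Finsupp.linearCombination ℂ (@fourier (1 : ℝ))

theorem trigPoly_single (k : ℤ) (a : ℂ) (t : UnitAddCircle) :
    trigPoly (Finsupp.single k a) t = a * fourier k t := by
  simp [trigPoly]

theorem exists_trigPoly_approx (g : C(UnitAddCircle, ℂ)) {ε : ℝ} (hε : 0 < ε) :
    ∃ d, ‖g - trigPoly d‖ < ε := by
  have hG : g ∈ closure (Submodule.span ℂ (Set.range (@fourier (1 : ℝ))) :
      Set C(UnitAddCircle, ℂ)) := by
    rw [← Submodule.topologicalClosure_coe, span_fourier_closure_eq_top]
    trivial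
  obtain ⟨f, hf, hfG⟩ := Metric.mem_closure_iff.1 hG ε hε
  obtain ⟨d, rfl⟩ := (Finsupp.mem_span_range_iff_exists_finsupp).1 hf
  refine ⟨d, ?_⟩
  rw [← dist_eq_norm]
  simpa [trigPoly, Finsupp.linearCombination_apply] using hfG

/-- A trigonometric polynomial splits as an analytic plus a conjugate analytic one. -/
theorem exists_entire_add_conj_entire (c : ℤ →₀ ℂ) :
    ∃ F G : ℂ → ℂ, Differentiable ℂ F ∧ Differentiable ℂ G ∧ G 0 = 0 ∧
      (∀ t, trigPoly (c.filter (0 ≤ ·)) t = F (fourier 1 t)) ∧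
      ∀ t, trigPoly c t = F (fourier 1 t) + (starRingEnd ℂ) (G (fourier 1 t)) := by
  induction c using Finsupp.induction_linear with
  | zero => exact ⟨0, 0, differentiable_const 0, differentiable_const 0, rfl,
      by simp [Finsupp.filter_zero], by simp⟩
  | add c d hc hd =>
    obtain ⟨F, G, hF, hG, hG0, h1, h2⟩ := hc
    obtain ⟨F', G', hF', hG', hG0', h1', h2'⟩ := hd
    refine ⟨fun z => F z + F' z, fun z => G z + G' z, hF.add hF', hG.add hG', by simp [*],
      fun t => ?_, fun t => ?_⟩
    · rw [Finsupp.filter_add, map_add, ContinuousMap.add_apply, h1, h1']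
    · rw [map_add, ContinuousMap.add_apply, h2, h2', map_add]; ring
  | single k a =>
    by_cases hk : 0 ≤ k
    · obtain ⟨n, rfl⟩ := Int.eq_ofNat_of_zero_le hk
      refine ⟨fun z => a * z ^ n, 0, by fun_prop, differentiable_const 0, rfl, fun t => ?_,
        fun t => ?_⟩
      · rw [Finsupp.filter_single_of_pos _ hk, trigPoly_single, fourier_natCast]
      · rw [trigPoly_single, fourier_natCast]; simp
    · obtain ⟨n, hn⟩ := Int.eq_ofNat_of_zero_le (a := -k) (by omega)
      obtain rfl : k = -(n : ℤ) := by omega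
      refine ⟨0, fun z => (starRingEnd ℂ) a * z ^ n, differentiable_const 0, by fun_prop,
        ?_, fun t => ?_, fun t => ?_⟩
      · simp; right; omega
      · rw [Finsupp.filter_single_of_neg _ hk]; simp
      · rw [trigPoly_single, fourier_neg, fourier_natCast]; simp

theorem enorm_integral_le_eLpNorm {p : ℝ≥0∞} (hp : 1 ≤ p) {f : UnitAddCircle → ℂ}
    (hf : Continuous f) :
    ‖∫ t, f t ∂(haarAddCircle : Measure UnitAddCircle)‖ₑ ≤ eLpNorm f p haarAddCircle := by
  refine (enorm_integral_le_lintegral_enorm _).trans ?_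
  rw [← eLpNorm_one_eq_lintegral_enorm]
  exact eLpNorm_le_eLpNorm_of_exponent_le hp hf.aestronglyMeasurable_of_compactSpace

/-- M. Riesz's theorem for the analytic projection, `1 < p ≤ 2`. -/
theorem exists_eLpNorm_filter_nonneg_le {p : ℝ} (hp1 : 1 < p) (hp2 : p ≤ 2) :
    ∃ C : ℝ≥0∞, C ≠ ∞ ∧ ∀ c : ℤ →₀ ℂ,
      eLpNorm (trigPoly (c.filter (0 ≤ ·))) (ENNReal.ofReal p) haarAddCircle ≤
        C * eLpNorm (trigPoly c) (ENNReal.ofReal p) haarAddCircle := by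
  obtain ⟨A, hA, h⟩ := exists_eLpNorm_le_re_of_im_zero hp1 hp2
  have hp1' : (1 : ℝ≥0∞) ≤ ENNReal.ofReal p := by simpa using hp1.le
  refine ⟨ENNReal.ofReal A + 1 + (ENNReal.ofReal A + 1), by finiteness, fun c => ?_⟩
  obtain ⟨F, G, hF, hG, hG0, h1, h2⟩ := exists_entire_add_conj_entire c
  set P := ENNReal.ofReal p
  set μ : Measure UnitAddCircle := haarAddCircle
  set X := eLpNorm (trigPoly c) P μ with hX
  have hcF : Continuous fun t : UnitAddCircle => F (fourier 1 t) :=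
    hF.continuous.comp (fourier 1).continuous
  have hcG : Continuous fun t : UnitAddCircle => G (fourier 1 t) :=
    hG.continuous.comp (fourier 1).continuous
  have hcG' : Continuous fun t : UnitAddCircle => (starRingEnd ℂ) (G (fourier 1 t)) :=
    Complex.continuous_conj.comp hcG
  have hmean : ∫ t, trigPoly c t ∂μ = F 0 := by
    simp_rw [h2]
    rw [integral_add (integrable_haar_of_continuous hcF)
      (integrable_haar_of_continuous hcG'), integral_conj,
      integral_comp_fourier_one hF.diffContOnCl, integral_comp_fourier_one hG.diffContOnCl, hG0]
    simp
  have hF0 : ‖F 0‖ₑ ≤ X := by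
    rw [← hmean]; exact enorm_integral_le_eLpNorm hp1' (trigPoly c).continuous
  -- Subtracting `i Im H(0)` reduces to functions real at the origin. That constant is controlled by
  -- `F 0`, the mean of the polynomial.
  have key : ∀ H : ℂ → ℂ, Differentiable ℂ H → ‖H 0‖ ≤ ‖F 0‖ →
      (∀ t : UnitAddCircle, |(H (fourier 1 t)).re| ≤ ‖trigPoly c t‖) →
      eLpNorm (fun t : UnitAddCircle => H (fourier 1 t)) P μ ≤ (ENNReal.ofReal A + 1) * X := by
    intro H hH hH0 hHf
    have h3 := h (fun z => H z - ((H 0).im : ℂ) * Complex.I) (by fun_prop) (by simp)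
    have hcH : Continuous fun t : UnitAddCircle => H (fourier 1 t) :=
      hH.continuous.comp (fourier 1).continuous
    have h4 : eLpNorm (fun t : UnitAddCircle =>
        (H (fourier 1 t) - ((H 0).im : ℂ) * Complex.I).re) P μ ≤ X := by
      refine eLpNorm_mono fun t => ?_
      simpa using hHf t
    have h5 : eLpNorm (fun _ : UnitAddCircle => ((H 0).im : ℂ) * Complex.I) P μ ≤ X := by
      rw [eLpNorm_const _ (by positivity) (NeZero.ne μ)]
      simp only [measure_univ, ENNReal.one_rpow, mul_one]
      refine le_trans ?_ hF0
      rw [enorm_le_iff_norm_le]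
      refine le_trans ?_ hH0
      simpa using Complex.abs_im_le_norm (H 0)
    have h6 : (fun t : UnitAddCircle => H (fourier 1 t)) =
        (fun t : UnitAddCircle => H (fourier 1 t) - ((H 0).im : ℂ) * Complex.I) +
        fun _ => ((H 0).im : ℂ) * Complex.I := by ext; simp
    rw [h6]
    refine (eLpNorm_add_le (hcH.sub continuous_const).aestronglyMeasurable_of_compactSpace
      aestronglyMeasurable_const hp1').trans ?_
    rw [add_mul, one_mul]
    exact add_le_add (h3.trans (by gcongr)) h5
  -- On the circle the polynomial is `F + conj G`. Its real part is that of `F + G`, and its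
  -- imaginary part is the real part of `-i (F - G)`; both test functions are entire, and they
  -- recover `F`.
  have k1 := key (fun z => F z + G z) (hF.add hG) (by simp [hG0]) fun t => by
    refine le_trans (le_of_eq ?_) (Complex.abs_re_le_norm _)
    rw [h2]; simp
  have k2 := key (fun z => -Complex.I * (F z - G z)) (by fun_prop) (by simp [hG0]) fun t => by
    refine le_trans (le_of_eq ?_) (Complex.abs_im_le_norm _)
    rw [h2]; simp [sub_eq_add_neg]
  have h7 : ⇑(trigPoly (c.filter (0 ≤ ·))) = (2⁻¹ : ℂ) •
      ((fun t : UnitAddCircle => F (fourier 1 t) + G (fourier 1 t)) +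
        Complex.I • fun t : UnitAddCircle => -Complex.I * (F (fourier 1 t) - G (fourier 1 t))) := by
    ext t
    simp only [h1, Pi.smul_apply, Pi.add_apply, smul_eq_mul, ← mul_assoc]
    simp
    ring
  rw [h7, eLpNorm_const_smul]
  calc _ ≤ (1 : ℝ≥0∞) * ((ENNReal.ofReal A + 1) * X + (ENNReal.ofReal A + 1) * X) := by
        gcongr
        · rw [← enorm_one (G := ℂ), enorm_le_iff_norm_le]; norm_num
        · refine (eLpNorm_add_le (hcF.add hcG).aestronglyMeasurable_of_compactSpace
            ((((hcF.sub hcG).const_mul _).const_smul _).aestronglyMeasurable_of_compactSpace) hp1').trans ?_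
          refine add_le_add k1 ?_
          rw [eLpNorm_const_smul]
          have hI : ‖Complex.I‖ₑ = 1 := by rw [← ofReal_norm]; simp
          rw [hI, one_mul]
          exact k2
    _ = _ := by rw [one_mul, add_mul (ENNReal.ofReal A + 1)]

/-- Modulation shifts frequencies, so cutting at `m` is conjugate to cutting at `0`. The modulating
factor is unimodular, so the resulting norm bound does not depend on `m`. -/
theorem trigPoly_filter_le_apply (m : ℤ) (c : ℤ →₀ ℂ) (t : UnitAddCircle) :
    trigPoly (c.filter (m ≤ ·)) t = fourier m t *
      trigPoly ((c.mapDomain (· - m)).filter (0 ≤ ·)) t ∧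
    trigPoly c t = fourier m t * trigPoly (c.mapDomain (· - m)) t := by
  induction c using Finsupp.induction_linear with
  | zero => simp [Finsupp.filter_zero]
  | add c d hc hd =>
    rw [Finsupp.filter_add, Finsupp.mapDomain_add, Finsupp.filter_add]
    simp only [map_add, ContinuousMap.add_apply, mul_add]
    rw [← hc.1, ← hd.1, ← hc.2, ← hd.2]
    exact ⟨rfl, rfl⟩
  | single k a =>
    have h : a * fourier k t = fourier m t * (a * fourier (k - m) t) := by
      rw [mul_left_comm, ← fourier_add]; simp
    rw [Finsupp.mapDomain_single, trigPoly_single, trigPoly_single]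
    refine ⟨?_, h⟩
    by_cases hk : m ≤ k
    · rw [Finsupp.filter_single_of_pos _ hk, Finsupp.filter_single_of_pos _ (by omega),
        trigPoly_single, trigPoly_single, h]
    · rw [Finsupp.filter_single_of_neg _ hk, Finsupp.filter_single_of_neg _ (by omega)]
      simp

/-- Partial sums are uniformly bounded in `L^p` on trigonometric polynomials, `1 < p ≤ 2`. -/
theorem exists_eLpNorm_filter_abs_le_of_le_two {p : ℝ} (hp1 : 1 < p) (hp2 : p ≤ 2) :
    ∃ C : ℝ≥0∞, C ≠ ∞ ∧ ∀ (N : ℕ) (c : ℤ →₀ ℂ),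
      eLpNorm (trigPoly (c.filter (|·| ≤ (N : ℤ)))) (ENNReal.ofReal p) haarAddCircle ≤
        C * eLpNorm (trigPoly c) (ENNReal.ofReal p) haarAddCircle := by
  obtain ⟨C, hC, h⟩ := exists_eLpNorm_filter_nonneg_le hp1 hp2
  have hp1' : (1 : ℝ≥0∞) ≤ ENNReal.ofReal p := by simpa using hp1.le
  have hmul : ∀ (m : ℤ) (f g : C(UnitAddCircle, ℂ)), (∀ t, f t = fourier m t * g t) →
      eLpNorm f (ENNReal.ofReal p) haarAddCircle = eLpNorm g (ENNReal.ofReal p) haarAddCircle := by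
    intro m f g hfg
    refine eLpNorm_congr_norm_ae (Eventually.of_forall fun t => ?_)
    rw [hfg, norm_mul, fourier_apply, Circle.norm_coe, one_mul]
  have hm : ∀ (m : ℤ) (c : ℤ →₀ ℂ),
      eLpNorm (trigPoly (c.filter (m ≤ ·))) (ENNReal.ofReal p) haarAddCircle ≤
        C * eLpNorm (trigPoly c) (ENNReal.ofReal p) haarAddCircle := by
    intro m c
    rw [hmul m _ _ fun t => (trigPoly_filter_le_apply m c t).1,
      hmul m _ _ fun t => (trigPoly_filter_le_apply m c t).2]
    exact h _
  refine ⟨C + C, by finiteness, fun N c => ?_⟩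
  -- The window is a difference of two half-lines, the second starting at `N + 1` so that the
  -- frequency `N` survives.
  have h1 : c.filter (|·| ≤ (N : ℤ)) = c.filter (-(N : ℤ) ≤ ·) - c.filter ((N : ℤ) + 1 ≤ ·) := by
    ext k
    simp only [Finsupp.filter_apply, Finsupp.sub_apply, abs_le]
    split_ifs <;> first | omega | simp
  rw [h1, map_sub, ContinuousMap.coe_sub, add_mul]
  exact (eLpNorm_sub_le (ContinuousMap.continuous _).aestronglyMeasurable_of_compactSpace
    (ContinuousMap.continuous _).aestronglyMeasurable_of_compactSpace hp1').trans
    (add_le_add (hm _ _) (hm _ _))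

/-! ### Duality and the range `p > 2`. -/

/-- Translation by half a period of the frequency `k - l` changes the sign of the integrand, while
Haar measure is invariant. -/
theorem integral_fourier_mul_conj_fourier {k l : ℤ} (h : k ≠ l) :
    ∫ t, (fourier k t : ℂ) * (starRingEnd ℂ) (fourier l t) ∂(haarAddCircle : Measure UnitAddCircle)
      = 0 := by
  have h1 := integral_add_right_eq_self (μ := (haarAddCircle : Measure UnitAddCircle))
    (fun t : UnitAddCircle => (fourier k t : ℂ) * (starRingEnd ℂ) (fourier l t))
    (((1 : ℝ) / 2 / ((k - l : ℤ) : ℝ) : ℝ) : UnitAddCircle)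
  simp only [← fourier_neg, ← fourier_add, ← sub_eq_add_neg] at h1 ⊢
  have h2 := fun t : UnitAddCircle => fourier_add_half_inv_index (sub_ne_zero.2 h) zero_lt_one t
  simp only [h2, integral_neg] at h1
  linear_combination -h1 / 2

/-- By orthogonality only equal frequencies pair, so frequency cut-offs are self-adjoint. This moves
the cut-off to the factor measured in the conjugate exponent. -/
theorem integral_trigPoly_filter_mul_conj (E : ℤ → Prop) [DecidablePred E] (c d : ℤ →₀ ℂ) :
    ∫ t, trigPoly (c.filter E) t * (starRingEnd ℂ) (trigPoly d t)
        ∂(haarAddCircle : Measure UnitAddCircle) =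
      ∫ t, trigPoly c t * (starRingEnd ℂ) (trigPoly (d.filter E) t) ∂haarAddCircle := by
  have hint : ∀ c d : ℤ →₀ ℂ, Integrable (fun t => trigPoly c t * (starRingEnd ℂ) (trigPoly d t))
      (haarAddCircle : Measure UnitAddCircle) := fun c d =>
    integrable_haar_of_continuous ((trigPoly c).continuous.mul
      (Complex.continuous_conj.comp (trigPoly d).continuous))
  induction c using Finsupp.induction_linear with
  | zero => simp [Finsupp.filter_zero]
  | add c c' hc hc' =>
    simp only [Finsupp.filter_add, map_add, ContinuousMap.add_apply, add_mul]
    rw [integral_add (hint _ _) (hint _ _), integral_add (hint _ _) (hint _ _), hc, hc']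
  | single k a =>
    induction d using Finsupp.induction_linear with
    | zero => simp [Finsupp.filter_zero]
    | add d d' hd hd' =>
      simp only [Finsupp.filter_add, map_add, ContinuousMap.add_apply, mul_add]
      rw [integral_add (hint _ _) (hint _ _), integral_add (hint _ _) (hint _ _), hd, hd']
    | single l b =>
      by_cases hkl : k = l
      · subst hkl
        by_cases hk : E k
        · rw [Finsupp.filter_single_of_pos _ hk, Finsupp.filter_single_of_pos _ hk]
        · rw [Finsupp.filter_single_of_neg _ hk, Finsupp.filter_single_of_neg _ hk]
          simp
      · have h0 : ∀ a b : ℂ, ∫ t, trigPoly (Finsupp.single k a) t *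
            (starRingEnd ℂ) (trigPoly (Finsupp.single l b) t)
            ∂(haarAddCircle : Measure UnitAddCircle) = 0 := by
          intro a b
          simp only [trigPoly_single, map_mul, mul_mul_mul_comm a]
          rw [integral_const_mul, integral_fourier_mul_conj_fourier hkl, mul_zero]
        have h1 : (Finsupp.single k a).filter E = Finsupp.single k (if E k then a else 0) := by
          by_cases hk : E k
          · rw [Finsupp.filter_single_of_pos _ hk, if_pos hk]
          · rw [Finsupp.filter_single_of_neg _ hk, if_neg hk, Finsupp.single_zero]
        have h2 : (Finsupp.single l b).filter E = Finsupp.single l (if E l then b else 0) := by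
          by_cases hk : E l
          · rw [Finsupp.filter_single_of_pos _ hk, if_pos hk]
          · rw [Finsupp.filter_single_of_neg _ hk, if_neg hk, Finsupp.single_zero]
        rw [h1, h2, h0, h0]

theorem enorm_integral_mul_conj_le {p q : ℝ} (hpq : p.HolderConjugate q) {f g : UnitAddCircle → ℂ}
    (hf : Continuous f) (hg : Continuous g) :
    ‖∫ t, f t * (starRingEnd ℂ) (g t) ∂(haarAddCircle : Measure UnitAddCircle)‖ₑ ≤
      eLpNorm f (ENNReal.ofReal p) haarAddCircle * eLpNorm g (ENNReal.ofReal q) haarAddCircle := by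
  refine (enorm_integral_le_lintegral_enorm _).trans ?_
  have h := ENNReal.lintegral_mul_le_Lp_mul_Lq (haarAddCircle : Measure UnitAddCircle) hpq
    (f := fun t => ‖f t‖ₑ) (g := fun t => ‖g t‖ₑ) hf.enorm.aemeasurable hg.enorm.aemeasurable
  rw [eLpNorm_eq_lintegral_rpow_enorm_toReal (by simpa using hpq.pos) ENNReal.ofReal_ne_top,
    eLpNorm_eq_lintegral_rpow_enorm_toReal (by simpa using hpq.symm.pos) ENNReal.ofReal_ne_top,
    ENNReal.toReal_ofReal hpq.nonneg, ENNReal.toReal_ofReal hpq.symm.nonneg]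
  refine le_trans (le_of_eq (lintegral_congr fun t => ?_)) h
  rw [enorm_mul, Pi.mul_apply, RCLike.enorm_conj]

theorem eLpNorm_le_norm (p : ℝ≥0∞) (f : C(UnitAddCircle, ℂ)) :
    eLpNorm f p (haarAddCircle : Measure UnitAddCircle) ≤ ENNReal.ofReal ‖f‖ := by
  refine (eLpNorm_le_of_ae_bound (C := ‖f‖) (Eventually.of_forall f.norm_coe_le_norm)).trans ?_
  simp

/-- A bound for the pairing with trigonometric polynomials bounds the `L^p` norm. -/
theorem eLpNorm_le_of_forall_trigPoly {p q : ℝ} (hp2 : 2 < p) (hpq : p.HolderConjugate q)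
    (F : C(UnitAddCircle, ℂ)) (M : ℝ≥0∞)
    (h : ∀ d, ‖∫ t, F t * (starRingEnd ℂ) (trigPoly d t)
      ∂(haarAddCircle : Measure UnitAddCircle)‖ₑ ≤
        M * eLpNorm (trigPoly d) (ENNReal.ofReal q) haarAddCircle) :
    eLpNorm F (ENNReal.ofReal p) haarAddCircle ≤ M := by
  by_cases hM : M = ∞
  · simp [hM]
  have hq1 : (1 : ℝ≥0∞) ≤ ENNReal.ofReal q := by simpa using hpq.symm.lt.le
  -- The extremal test function below need not be a trigonometric polynomial, so the hypothesis is
  -- first extended by uniform density.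
  have hgen : ∀ g : C(UnitAddCircle, ℂ), ‖∫ t, F t * (starRingEnd ℂ) (g t)
      ∂(haarAddCircle : Measure UnitAddCircle)‖ₑ ≤
        M * eLpNorm g (ENNReal.ofReal q) haarAddCircle := by
    intro g
    have key : ∀ ε : ℝ, 0 < ε → ‖∫ t, F t * (starRingEnd ℂ) (g t)
        ∂(haarAddCircle : Measure UnitAddCircle)‖ₑ ≤
        M * (eLpNorm g (ENNReal.ofReal q) haarAddCircle + ENNReal.ofReal ε) +
          eLpNorm F (ENNReal.ofReal p) haarAddCircle * ENNReal.ofReal ε := by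
      intro ε hε
      obtain ⟨d, hd⟩ := exists_trigPoly_approx g hε
      have hsmall : eLpNorm (g - trigPoly d) (ENNReal.ofReal q) haarAddCircle ≤
          ENNReal.ofReal ε :=
        (eLpNorm_le_norm _ (g - trigPoly d)).trans (ENNReal.ofReal_le_ofReal hd.le)
      have h1 : ∀ t, F t * (starRingEnd ℂ) (g t) = F t * (starRingEnd ℂ) (trigPoly d t) +
          F t * (starRingEnd ℂ) ((g - trigPoly d) t) := by
        intro t; simp; ring
      have hint : ∀ g : C(UnitAddCircle, ℂ), Integrable (fun t => F t * (starRingEnd ℂ) (g t))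
          (haarAddCircle : Measure UnitAddCircle) := fun g =>
        integrable_haar_of_continuous (F.continuous.mul
          (Complex.continuous_conj.comp g.continuous))
      simp_rw [h1]
      rw [integral_add (hint _) (hint _)]
      refine (enorm_add_le _ _).trans (add_le_add ((h d).trans ?_)
        ((enorm_integral_mul_conj_le hpq F.continuous (g - trigPoly d).continuous).trans ?_))
      · gcongr
        have h2 : ⇑(trigPoly d) = ⇑g - ⇑(g - trigPoly d) := by ext; simp
        rw [h2]
        exact (eLpNorm_sub_le g.continuous.aestronglyMeasurable_of_compactSpace
          (g - trigPoly d).continuous.aestronglyMeasurable_of_compactSpace hq1).trans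
          (by gcongr)
      · gcongr
    have hFtop : eLpNorm F (ENNReal.ofReal p) haarAddCircle ≠ ∞ :=
      (memLp_haar_of_continuous F.continuous _).eLpNorm_ne_top
    have hε : Tendsto (fun ε : ℝ => ENNReal.ofReal ε) (𝓝[>] 0) (𝓝 0) := by
      have := (ENNReal.continuous_ofReal.tendsto 0).mono_left
        (nhdsWithin_le_nhds (a := (0 : ℝ)) (s := Set.Ioi 0))
      simpa using this
    have ht := (ENNReal.Tendsto.const_mul (a := M) ((hε.const_add
      (eLpNorm g (ENNReal.ofReal q) haarAddCircle))) (Or.inr hM)).add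
      (ENNReal.Tendsto.const_mul (a := eLpNorm F (ENNReal.ofReal p) haarAddCircle) hε
        (Or.inr hFtop))
    have := ge_of_tendsto ht (eventually_nhdsWithin_of_forall fun ε hε => key ε hε)
    simpa using this
  have hp0 : 0 < p := hpq.pos
  -- The equality case of Hölder: `F * conj g = ‖F‖ ^ p` and `‖g‖ ^ q = ‖F‖ ^ p`. Since `p > 2`, it
  -- is continuous even at zeros of `F`.
  let g : C(UnitAddCircle, ℂ) := ⟨fun t => ((‖F t‖ ^ (p - 2) : ℝ) : ℂ) * F t, by
    have : Continuous fun t => ‖F t‖ ^ (p - 2) :=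
      F.continuous.norm.rpow_const fun t => Or.inr (by linarith)
    exact (Complex.continuous_ofReal.comp this).mul F.continuous⟩
  set Y : ℝ := ∫ t, ‖F t‖ ^ p ∂(haarAddCircle : Measure UnitAddCircle) with hY
  have hY0 : 0 ≤ Y := integral_nonneg fun t => by positivity
  have hFY := eLpNorm_rpow_toReal hp0 (memLp_haar_of_continuous F.continuous (ENNReal.ofReal p))
  have hgY := eLpNorm_rpow_toReal hpq.symm.pos
    (memLp_haar_of_continuous g.continuous (ENNReal.ofReal q))
  have hgn : ∀ t, ‖g t‖ ^ q = ‖F t‖ ^ p := by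
    intro t
    have hn : ‖g t‖ = ‖F t‖ ^ (p - 1) := by
      change ‖((‖F t‖ ^ (p - 2) : ℝ) : ℂ) * F t‖ = _
      rw [norm_mul, Complex.norm_real, Real.norm_of_nonneg (by positivity),
        show p - 1 = p - 2 + 1 by ring, Real.rpow_add_one' (norm_nonneg _) (by linarith)]
    rw [hn, ← Real.rpow_mul (norm_nonneg _), hpq.sub_one_mul_conj]
  have hpair : ∫ t, F t * (starRingEnd ℂ) (g t) ∂(haarAddCircle : Measure UnitAddCircle) =
      (Y : ℂ) := by
    rw [hY, ← integral_complex_ofReal]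
    refine integral_congr_ae (Eventually.of_forall fun t => ?_)
    change F t * (starRingEnd ℂ) (((‖F t‖ ^ (p - 2) : ℝ) : ℂ) * F t) = _
    rw [map_mul, Complex.conj_ofReal, mul_left_comm, Complex.mul_conj, ← Complex.ofReal_mul,
      Complex.normSq_eq_norm_sq, ← Real.rpow_natCast, ← Real.rpow_add' (norm_nonneg _)]
    · norm_num
    · norm_num; linarith
  have hmain := hgen g
  simp_rw [hgn] at hgY
  rw [hpair, ← ofReal_norm, Complex.norm_real, Real.norm_of_nonneg hY0] at hmain
  set a := eLpNorm F (ENNReal.ofReal p) haarAddCircle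
  set b := eLpNorm g (ENNReal.ofReal q) haarAddCircle
  have hatop : a ≠ ∞ := (memLp_haar_of_continuous F.continuous _).eLpNorm_ne_top
  by_cases ha : a = 0
  · simp [ha]
  have hb : b = a ^ (p - 1) := by
    rw [← hFY] at hgY
    have : (b ^ q) ^ q⁻¹ = (a ^ p) ^ q⁻¹ := by rw [hgY]
    rw [← ENNReal.rpow_mul, ← ENNReal.rpow_mul, mul_inv_cancel₀ hpq.symm.ne_zero,
      ENNReal.rpow_one] at this
    rw [this]
    congr 1
    have := hpq.inv_add_inv_eq_one
    field_simp [hpq.symm.ne_zero, hpq.ne_zero] at this ⊢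
    linarith
  rw [← hFY, hb, show a ^ p = a * a ^ (p - 1) by
    conv_rhs => rw [← ENNReal.rpow_one a, ← ENNReal.rpow_mul, ← ENNReal.rpow_add _ _ ha hatop]
    congr 1; ring] at hmain
  exact (ENNReal.mul_le_mul_iff_left (by simp [ha, hatop]) (by
    exact ENNReal.rpow_ne_top_of_nonneg (by linarith) hatop)).1 hmain

/-- **M. Riesz**: the partial sums are uniformly bounded in `L^p` on trigonometric polynomials. -/
theorem exists_eLpNorm_filter_abs_le {p : ℝ≥0∞} (hp1 : 1 < p) (hp : p < ∞) :
    ∃ C : ℝ≥0∞, C ≠ ∞ ∧ ∀ (N : ℕ) (c : ℤ →₀ ℂ),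
      eLpNorm (trigPoly (c.filter (|·| ≤ (N : ℤ)))) p haarAddCircle ≤
        C * eLpNorm (trigPoly c) p haarAddCircle := by
  lift p to NNReal using hp.ne
  have hp1' : (1 : ℝ) < p := by exact_mod_cast hp1
  rw [← ENNReal.ofReal_coe_nnreal]
  rcases le_or_gt (p : ℝ) 2 with hp2 | hp2
  · exact exists_eLpNorm_filter_abs_le_of_le_two hp1' hp2
  · have hpq := Real.HolderConjugate.conjExponent hp1'
    set q := Real.conjExponent p
    obtain ⟨C, hC, h⟩ := exists_eLpNorm_filter_abs_le_of_le_two hpq.symm.lt (by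
      have := hpq.inv_add_inv_eq_one
      have h2 : (p : ℝ)⁻¹ < 2⁻¹ := by gcongr
      have h3 : 2⁻¹ ≤ q⁻¹ := by linarith
      exact (inv_le_inv₀ two_pos hpq.symm.pos).1 h3)
    refine ⟨C, hC, fun N c => eLpNorm_le_of_forall_trigPoly hp2 hpq _ _ fun d => ?_⟩
    rw [integral_trigPoly_filter_mul_conj]
    refine (enorm_integral_mul_conj_le hpq (trigPoly c).continuous
      (ContinuousMap.continuous _)).trans ?_
    calc _ ≤ eLpNorm (trigPoly c) (ENNReal.ofReal p) haarAddCircle *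
        (C * eLpNorm (trigPoly d) (ENNReal.ofReal q) haarAddCircle) := by gcongr; exact h N d
      _ = _ := by ring

/-! ### Absolutely convergent trigonometric series. -/

theorem continuous_eLpNorm_haar {p : ℝ≥0∞} (hp : 1 ≤ p) :
    Continuous fun f : C(UnitAddCircle, ℂ) => eLpNorm f p haarAddCircle := by
  have : Fact (1 ≤ p) := ⟨hp⟩
  have h : (fun f : C(UnitAddCircle, ℂ) => eLpNorm f p haarAddCircle) =
      fun f => ‖ContinuousMap.toLp (E := ℂ) p haarAddCircle ℂ f‖ₑ := by
    ext f
    rw [Lp.enorm_def]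
    exact eLpNorm_congr_ae (ContinuousMap.coeFn_toLp (haarAddCircle) f).symm
  rw [h]
  exact (ContinuousLinearMap.continuous _).enorm

/-- Uniform boundedness of partial sums for absolutely convergent trigonometric series. -/
theorem exists_eLpNorm_tsum_abs_le {p : ℝ≥0∞} (hp1 : 1 < p) (hp : p < ∞) :
    ∃ C : ℝ≥0∞, C ≠ ∞ ∧ ∀ {ι : Type} (c : ι → ℂ) (k : ι → ℤ) (N : ℕ), Summable (fun i => ‖c i‖) →
      eLpNorm (fun t : UnitAddCircle =>
        ∑' i, (if |k i| ≤ (N : ℤ) then c i else 0) * fourier (k i) t) p haarAddCircle ≤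
        C * eLpNorm (fun t : UnitAddCircle => ∑' i, c i * fourier (k i) t) p haarAddCircle := by
  classical
  obtain ⟨C, hC, h⟩ := exists_eLpNorm_filter_abs_le hp1 hp
  refine ⟨C, hC, fun {ι} c k N hc => ?_⟩
  -- The map `k` need not be injective: later many multi-indices share one `j`-th exponent. Sums of
  -- `Finsupp.single` merge repeated frequencies, and the finite sums converge uniformly.
  have hser : ∀ c : ι → ℂ, Summable (fun i => ‖c i‖) →
      Tendsto (fun s : Finset ι => eLpNorm
        (trigPoly (∑ i ∈ s, Finsupp.single (k i) (c i))) p haarAddCircle) atTop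
        (𝓝 (eLpNorm (fun t : UnitAddCircle => ∑' i, c i * fourier (k i) t) p haarAddCircle)) := by
    intro c hc
    have hsum : Summable fun i => c i • (fourier (k i) : C(UnitAddCircle, ℂ)) := by
      refine Summable.of_norm ?_
      simpa [norm_smul, fourier_norm] using hc
    have h1 : (fun t : UnitAddCircle => ∑' i, c i * fourier (k i) t) =
        ⇑(∑' i, c i • (fourier (k i) : C(UnitAddCircle, ℂ))) := by
      ext t
      exact ContinuousMap.tsum_apply hsum t
    have h2 : ∀ s : Finset ι, trigPoly (∑ i ∈ s, Finsupp.single (k i) (c i)) =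
        ∑ i ∈ s, c i • (fourier (k i) : C(UnitAddCircle, ℂ)) := by
      intro s
      simp [trigPoly]
    simp_rw [h1, h2]
    exact ((continuous_eLpNorm_haar hp1.le).tendsto _).comp hsum.hasSum
  have hc' : Summable fun i => ‖if |k i| ≤ (N : ℤ) then c i else 0‖ := by
    refine Summable.of_nonneg_of_le (fun i => norm_nonneg _) (fun i => ?_) hc
    split_ifs <;> simp
  refine le_of_tendsto_of_tendsto' (hser _ hc')
    (ENNReal.Tendsto.const_mul (hser c hc) (Or.inr hC)) fun s => ?_
  have h3 : ∑ i ∈ s, Finsupp.single (k i) (if |k i| ≤ (N : ℤ) then c i else 0) =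
      (∑ i ∈ s, Finsupp.single (k i) (c i)).filter (|·| ≤ (N : ℤ)) := by
    induction s using Finset.induction_on with
    | empty => simp [Finsupp.filter_zero]
    | insert i s hi ih =>
      rw [Finset.sum_insert hi, Finset.sum_insert hi, Finsupp.filter_add, ih]
      congr 1
      split_ifs with hk
      · exact (Finsupp.filter_single_of_pos (fun x : ℤ => |x| ≤ (N : ℤ)) hk).symm
      · rw [Finsupp.filter_single_of_neg (fun x : ℤ => |x| ≤ (N : ℤ)) hk, Finsupp.single_zero]
  rw [h3]
  exact h N _

/-! ### Torus rotations and Fourier coefficients along torus orbits. -/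

open UnitAddTorus

variable {n : ℕ}

/-- Rotation of the coordinates of `z` by the angles `2πt`. -/
noncomputable def rot (t : UnitAddTorus (Fin n)) (z : Fin n → ℂ) : Fin n → ℂ :=
  fun j => fourier 1 (t j) * z j

/-- The product of the normalized Haar measures on the torus. -/
noncomputable abbrev torusHaar (n : ℕ) : Measure (UnitAddTorus (Fin n)) :=
  Measure.pi fun _ => haarAddCircle

theorem IsReinhardt.rot_mem {R : Set (Fin n → ℂ)} (hR : IsReinhardt R)
    (t : UnitAddTorus (Fin n)) {z : Fin n → ℂ} (hz : z ∈ R) : rot t z ∈ R := by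
  choose x hx using fun j => QuotientAddGroup.mk_surjective (t j)
  have h := hR z hz fun j => 2 * Real.pi * x j
  convert h using 1
  ext j
  simp only [rot, ← hx]
  rw [fourier_coe_apply]
  push_cast
  congr 2
  ring

@[fun_prop]
theorem continuous_uncurry_rot :
    Continuous fun q : UnitAddTorus (Fin n) × (Fin n → ℂ) => rot q.1 q.2 := by
  unfold rot
  fun_prop

theorem rot_add (s t : UnitAddTorus (Fin n)) (z : Fin n → ℂ) :
    rot (t + s) z = rot t (rot s z) := by
  ext j
  simp only [rot, Pi.add_apply, fourier_one, AddCircle.toCircle_add, Circle.coe_mul]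
  ring

theorem rot_zero (z : Fin n → ℂ) : rot 0 z = z := by
  ext j
  simp [rot]

theorem fourier_one_zpow (m : ℤ) (t : UnitAddCircle) : (fourier 1 t : ℂ) ^ m = fourier m t := by
  rw [fourier_one, fourier_apply, AddCircle.toCircle_zsmul, Circle.coe_zpow]

theorem laurentMonomial_rot (α : Fin n → ℤ) (t : UnitAddTorus (Fin n)) (z : Fin n → ℂ) :
    laurentMonomial α (rot t z) = mFourier α t * laurentMonomial α z := by
  simp only [laurentMonomial, rot, mul_zpow, Finset.prod_mul_distrib, mFourier,
    ContinuousMap.coe_mk, fourier_one_zpow]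

theorem norm_mFourier_apply (α : Fin n → ℤ) (t : UnitAddTorus (Fin n)) :
    ‖(mFourier α t : ℂ)‖ = 1 := by
  simp [mFourier, fourier_apply, Circle.norm_coe]

theorem laurentMonomial_ne_zero (α : Fin n → ℤ) {z : Fin n → ℂ} (hz : ∀ j, z j ≠ 0) :
    laurentMonomial α z ≠ 0 :=
  Finset.prod_ne_zero_iff.2 fun j _ => zpow_ne_zero _ (hz j)

/-- The Fourier coefficients of the restrictions of `f` to the tori centred at the origin. -/
noncomputable def torusCoeff (f : (Fin n → ℂ) → ℂ) (α : Fin n → ℤ) (z : Fin n → ℂ) : ℂ :=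
  mFourierCoeff (fun t => f (rot t z)) α

theorem torusCoeff_eq_integral (f : (Fin n → ℂ) → ℂ) (α : Fin n → ℤ) (z : Fin n → ℂ) :
    torusCoeff f α z = ∫ t, mFourier (-α) t * f (rot t z) ∂torusHaar n := rfl

/-- Invariance of Haar measure under translation by `s`. This is the transformation law of the
monomial, so the quotient by the monomial is rotation invariant where defined. -/
theorem torusCoeff_rot (f : (Fin n → ℂ) → ℂ) (α : Fin n → ℤ) (s : UnitAddTorus (Fin n))
    (z : Fin n → ℂ) : torusCoeff f α (rot s z) = mFourier α s * torusCoeff f α z := by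
  simp only [torusCoeff_eq_integral]
  rw [← integral_const_mul, ← integral_add_right_eq_self (μ := torusHaar n)
    (fun t => mFourier α s * (mFourier (-α) t * f (rot t z))) s]
  refine integral_congr_ae (Eventually.of_forall fun t => ?_)
  have h : mFourier α s * (mFourier (-α) s : ℂ) = 1 := by
    rw [← mFourier_add]; simp [mFourier_zero]
  simp only [rot_add]
  have h2 : mFourier (-α) (t + s) = mFourier (-α) t * (mFourier (-α) s : ℂ) := by
    simp only [mFourier, ContinuousMap.coe_mk, ← Finset.prod_mul_distrib, Pi.add_apply,
      fourier_apply, smul_add, AddCircle.toCircle_add, Circle.coe_mul]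
  rw [h2]
  linear_combination (-mFourier (-α) t * f (rot t (rot s z))) * h

/-! ### Torus coefficients are multiples of monomials. -/

/-- `g` is holomorphic along all complex lines in `R`. -/
def HolomorphicOnLines {E : Type*} [AddCommGroup E] [Module ℂ E] (g : E → ℂ) (R : Set E) : Prop :=
  ∀ w v : E, ∀ l : ℂ, w + l • v ∈ R → DifferentiableAt ℂ (fun m : ℂ => g (w + m • v)) l

/-- Differentiation under the torus integral, dominated through the Cauchy estimate. One-variable
holomorphy along lines is enough for the identity theorem that follows. -/
theorem torusCoeff_holomorphicOnLines {R : Set (Fin n → ℂ)} (hRo : IsOpen R) (hR : IsReinhardt R)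
    {f : (Fin n → ℂ) → ℂ} (hf : DifferentiableOn ℂ f R) (α : Fin n → ℤ) :
    HolomorphicOnLines (torusCoeff f α) R := by
  intro w v l hl
  have hlin : Continuous fun m : ℂ => w + m • v := by fun_prop
  obtain ⟨r, hr, hball⟩ : ∃ r > 0, Metric.closedBall l (2 * r) ⊆ {m : ℂ | w + m • v ∈ R} := by
    obtain ⟨r, hr, h⟩ := Metric.nhds_basis_closedBall.mem_iff.1
      ((hRo.preimage hlin).mem_nhds hl)
    exact ⟨r / 2, by positivity, by rwa [mul_div_cancel₀ _ two_ne_zero]⟩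
  have hcont : ContinuousOn (fun q : UnitAddTorus (Fin n) × ℂ => f (rot q.1 (w + q.2 • v)))
      (Set.univ ×ˢ Metric.closedBall l (2 * r)) := by
    refine hf.continuousOn.comp (Continuous.continuousOn ?_) fun q hq =>
      hR.rot_mem _ (hball hq.2)
    exact continuous_uncurry_rot.comp (continuous_fst.prodMk (hlin.comp continuous_snd))
  obtain ⟨M, hM⟩ := (isCompact_univ.prod (isCompact_closedBall l (2 * r))).exists_bound_of_continuousOn
    hcont
  have hdiff : ∀ t : UnitAddTorus (Fin n), ∀ m ∈ Metric.closedBall l (2 * r),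
      DifferentiableAt ℂ (fun m : ℂ => f (rot t (w + m • v))) m := by
    intro t m hm
    have h1 : DifferentiableAt ℂ f (rot t (w + m • v)) :=
      hf.differentiableAt (hRo.mem_nhds (hR.rot_mem t (hball hm)))
    refine h1.comp (g := f) (f := fun m : ℂ => rot t (w + m • v)) m ?_
    unfold rot
    refine differentiableAt_pi.2 fun j => ?_
    simp only [Pi.add_apply, Pi.smul_apply, smul_eq_mul]
    fun_prop
  have hct : ∀ m ∈ Metric.closedBall l (2 * r),
      Continuous fun t : UnitAddTorus (Fin n) => mFourier (-α) t * f (rot t (w + m • v)) := by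
    intro m hm
    refine (ContinuousMap.continuous _).mul ?_
    refine hf.continuousOn.comp_continuous ?_ fun t => hR.rot_mem t (hball hm)
    exact continuous_uncurry_rot.comp (continuous_id.prodMk continuous_const)
  have hsub : Metric.ball l r ⊆ Metric.closedBall l (2 * r) := fun m hm => by
    rw [Metric.mem_ball] at hm; rw [Metric.mem_closedBall]; linarith
  have hlm : l ∈ Metric.closedBall l (2 * r) := by simp [hr.le]
  simp only [torusCoeff_eq_integral]
  refine (hasDerivAt_integral_of_dominated_loc_of_deriv_le (μ := torusHaar n) (𝕜 := ℂ)
    (F := fun m t => mFourier (-α) t * f (rot t (w + m • v)))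
    (F' := fun m t => mFourier (-α) t * deriv (fun m : ℂ => f (rot t (w + m • v))) m)
    (bound := fun _ => M / r) (Metric.ball_mem_nhds l hr) ?_ ?_ ?_ ?_ ?_ ?_).2.differentiableAt
  · filter_upwards [Metric.ball_mem_nhds l hr] with m hm
    exact (hct m (hsub hm)).aestronglyMeasurable_of_compactSpace
  · exact (hct l hlm).integrable_of_hasCompactSupport (HasCompactSupport.of_compactSpace _)
  -- The derivative is measurable in `t` as a pointwise limit of difference quotients that are
  -- continuous in `t`.
  · let x : ℕ → ℂ := fun k => l + ((r / ((k : ℝ) + 1) : ℝ) : ℂ)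
    have hxr : ∀ k : ℕ, 0 < r / ((k : ℝ) + 1) := fun k => by positivity
    have hxb : ∀ k, x k ∈ Metric.closedBall l (2 * r) := by
      intro k
      rw [Metric.mem_closedBall, dist_eq_norm]
      simp only [x, add_sub_cancel_left, Complex.norm_real, Real.norm_of_nonneg (hxr k).le]
      have : r / ((k : ℝ) + 1) ≤ r := div_le_self hr.le (by linarith [k.cast_nonneg (α := ℝ)])
      linarith
    have hxt : Tendsto x atTop (𝓝[≠] l) := by
      refine tendsto_nhdsWithin_iff.2 ⟨?_, Eventually.of_forall fun k => ?_⟩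
      · have h1 : Tendsto (fun k : ℕ => r / ((k : ℝ) + 1)) atTop (𝓝 0) :=
          tendsto_const_nhds.div_atTop (tendsto_natCast_atTop_atTop.atTop_add tendsto_const_nhds)
        have h2 := (Complex.continuous_ofReal.tendsto 0).comp h1
        simpa [x] using h2.const_add l
      · have := (hxr k).ne'
        intro h
        have h' : ((r / ((k : ℝ) + 1) : ℝ) : ℂ) = 0 := by
          simpa only [x, Set.mem_singleton_iff, add_eq_left] using h
        exact this (Complex.ofReal_eq_zero.1 h')
    refine aestronglyMeasurable_of_tendsto_ae (u := atTop) (f := fun (k : ℕ) t =>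
      (x k - l)⁻¹ * (mFourier (-α) t * f (rot t (w + x k • v)) -
        mFourier (-α) t * f (rot t (w + l • v)))) (fun k => ?_)
        (Eventually.of_forall fun t => ?_)
    · exact (((hct _ (hxb k)).sub (hct l hlm)).const_mul _).aestronglyMeasurable_of_compactSpace
    · have h1 := (hasDerivAt_iff_tendsto_slope.1 (hdiff t l hlm).hasDerivAt).comp hxt
      refine (h1.const_mul (mFourier (-α) t : ℂ)).congr fun k => ?_
      simp only [Function.comp, slope, vsub_eq_sub, smul_eq_mul]
      ring
  · refine Eventually.of_forall fun t m hm => ?_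
    rw [norm_mul, norm_mFourier_apply, one_mul]
    have hm' : Metric.closedBall m r ⊆ Metric.closedBall l (2 * r) := by
      refine Metric.closedBall_subset_closedBall' ?_
      have := Metric.mem_ball.1 hm
      linarith
    refine Complex.norm_deriv_le_of_forall_mem_sphere_norm_le hr ?_ fun x hx =>
      hM (t, x) ⟨Set.mem_univ _, hm' (Metric.sphere_subset_closedBall hx)⟩
    refine DifferentiableOn.diffContOnCl fun x hx => (hdiff t x (hm' ?_)).differentiableWithinAt
    rwa [closure_ball _ hr.ne'] at hx
  · exact integrable_const _
  · refine Eventually.of_forall fun t m hm => ?_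
    exact (hdiff t m (hsub hm)).hasDerivAt.const_mul _

/-- Identity theorem for functions holomorphic along complex lines. -/
theorem HolomorphicOnLines.eq_zero_of_preconnected {E : Type*} [NormedAddCommGroup E]
    [NormedSpace ℂ E] {g : E → ℂ} {R : Set E} (hg : HolomorphicOnLines g R) (hRo : IsOpen R)
    (hRc : IsPreconnected R) {z₀ : E} (hz₀ : z₀ ∈ R) (h0 : ∀ᶠ z in 𝓝 z₀, g z = 0)
    {z : E} (hz : z ∈ R) : g z = 0 := by
  have hmain : R ⊆ {z | ∀ᶠ y in 𝓝 z, g y = 0} := by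
    refine hRc.subset_of_closure_inter_subset isOpen_setOfPred_eventually_nhds ⟨z₀, hz₀, h0⟩ ?_
    rintro z ⟨hzc, hzR⟩
    obtain ⟨ε, hε, hball⟩ := Metric.isOpen_iff.1 hRo z hzR
    obtain ⟨w, hw, hwz⟩ := Metric.mem_closure_iff.1 hzc ε hε
    have hwb : w ∈ Metric.ball z ε := by rwa [Metric.mem_ball, dist_comm]
    filter_upwards [Metric.ball_mem_nhds z hε] with y hy
    -- The complex line through `w` and `y` meets the ball in a convex set of parameters containing
    -- `0` and `1`; `g` vanishes near parameter `0`, hence at `1`.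
    let L : ℂ → E := fun m => w + m • (y - w)
    have hL : Continuous L := by fun_prop
    have hDc : Convex ℝ (L ⁻¹' Metric.ball z ε) := by
      intro a ha b hb s t hs ht hst
      have h := convex_ball z ε (Set.mem_preimage.1 ha) (Set.mem_preimage.1 hb) hs ht hst
      rw [Set.mem_preimage]
      convert h using 1
      have hs' : s = 1 - t := by linarith
      simp only [L, hs', Complex.real_smul, ← Complex.coe_smul (E := E)]
      push_cast
      module
    have hana : AnalyticOnNhd ℂ (fun m => g (L m)) (L ⁻¹' Metric.ball z ε) := by
      refine DifferentiableOn.analyticOnNhd (fun m hm => ?_) (Metric.isOpen_ball.preimage hL)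
      exact (hg w (y - w) m (hball hm)).differentiableWithinAt
    have hev : (fun m => g (L m)) =ᶠ[𝓝 0] 0 := by
      have : Tendsto L (𝓝 0) (𝓝 w) := by simpa [L] using hL.tendsto 0
      exact this.eventually hw
    have := hana.eqOn_zero_of_preconnected_of_eventuallyEq_zero hDc.isPreconnected
      (by simpa [L] using hwb) hev (show (1 : ℂ) ∈ _ by simpa [L] using hy)
    simpa [L] using this
  exact (hmain hz).self_of_nhds

theorem exists_mem_forall_ne_zero {R : Set (Fin n → ℂ)} (hRo : IsOpen R) {z : Fin n → ℂ}
    (hz : z ∈ R) : ∃ w ∈ R, ∀ j, w j ≠ 0 := by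
  obtain ⟨ε, hε, hball⟩ := Metric.nhds_basis_closedBall.mem_iff.1 (hRo.mem_nhds hz)
  refine ⟨fun j => if z j = 0 then (ε : ℂ) else z j, hball ?_, fun j => ?_⟩
  · rw [Metric.mem_closedBall, dist_pi_le_iff hε.le]
    intro j
    split_ifs with h
    · simp [h, abs_of_pos hε]
    · simp [hε.le]
  · beta_reduce
    split_ifs with h
    · exact_mod_cast hε.ne'
    · exact h

/-- A function holomorphic on a disc that is invariant under small rotations is constant. -/
theorem eq_of_rotation_invariant {φ : ℂ → ℂ} {c : ℂ} {ε : ℝ}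
    (hφ : DifferentiableOn ℂ φ (Metric.ball c ε)) (h0 : ∀ ζ ∈ Metric.ball c ε, ζ ≠ 0)
    (hrot : ∀ θ : ℝ, ∀ ζ, ζ ∈ Metric.ball c ε →
      Complex.exp (θ * Complex.I) * ζ ∈ Metric.ball c ε → φ (Complex.exp (θ * Complex.I) * ζ) = φ ζ)
    {z w : ℂ} (hz : z ∈ Metric.ball c ε) (hw : w ∈ Metric.ball c ε) : φ z = φ w := by
  refine Metric.isOpen_ball.is_const_of_deriv_eq_zero (convex_ball c ε).isPreconnected hφ
    (fun ζ hζ => ?_) hz hw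
  -- Differentiating along the arc `θ ↦ e^{iθ} ζ` gives `φ'(ζ) i ζ = 0`, and `ζ ≠ 0`.
  have hd : HasDerivAt φ (deriv φ ζ) (Complex.exp (((0 : ℝ) : ℂ) * Complex.I) * ζ) := by
    simpa using (hφ.differentiableAt (Metric.isOpen_ball.mem_nhds hζ)).hasDerivAt
  have hcurve : HasDerivAt (fun θ : ℝ => Complex.exp ((θ : ℂ) * Complex.I) * ζ)
      (Complex.I * ζ) 0 := by
    have h1 : HasDerivAt (fun θ : ℝ => ((θ : ℂ) * Complex.I)) Complex.I 0 := by
      simpa using (Complex.ofRealCLM.hasDerivAt (x := (0 : ℝ))).mul_const Complex.I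
    simpa using h1.cexp.mul_const ζ
  have hcomp : HasDerivAt (fun θ : ℝ => φ (Complex.exp ((θ : ℂ) * Complex.I) * ζ))
      (deriv φ ζ * (Complex.I * ζ)) 0 := by
    have := HasDerivAt.scomp (𝕜 := ℝ) (𝕜' := ℂ) (0 : ℝ) hd hcurve
    simpa [mul_comm, Function.comp_def] using this
  have hev : (fun θ : ℝ => φ (Complex.exp ((θ : ℂ) * Complex.I) * ζ)) =ᶠ[𝓝 0] fun _ => φ ζ := by
    have hc : Tendsto (fun θ : ℝ => Complex.exp ((θ : ℂ) * Complex.I) * ζ) (𝓝 0) (𝓝 ζ) := by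
      simpa using hcurve.continuousAt.tendsto
    filter_upwards [hc.eventually (Metric.isOpen_ball.mem_nhds hζ)] with θ hθ
    exact hrot θ ζ hζ hθ
  have h2 := hcomp.unique ((hasDerivAt_const (0 : ℝ) (φ ζ)).congr_of_eventuallyEq hev)
  have h3 : Complex.I * ζ ≠ 0 := mul_ne_zero Complex.I_ne_zero (h0 ζ hζ)
  exact (mul_eq_zero.1 h2).resolve_right h3

theorem exists_rot_eq_update (θ : ℝ) (z : Fin n → ℂ) (j : Fin n) :
    ∃ t : UnitAddTorus (Fin n),
      rot t z = Function.update z j (Complex.exp (θ * Complex.I) * z j) := by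
  refine ⟨Pi.single j ((θ / (2 * Real.pi) : ℝ) : UnitAddCircle), ?_⟩
  ext i
  by_cases h : i = j
  · subst h
    simp only [rot, Pi.single_eq_same, Function.update_self]
    rw [fourier_coe_apply]
    congr 2
    push_cast
    field_simp [Real.pi_ne_zero]
  · simp [rot, h]

theorem differentiableAt_laurentMonomial (α : Fin n → ℤ) {z : Fin n → ℂ}
    (hz : ∀ j, α j < 0 → z j ≠ 0) : DifferentiableAt ℂ (laurentMonomial α) z := by
  unfold laurentMonomial
  have h : ∀ j, DifferentiableAt ℂ (fun z : Fin n → ℂ => z j ^ α j) z := by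
    intro j
    rcases lt_or_ge (α j) 0 with h | h
    · exact (differentiableAt_apply j z).zpow (Or.inl (hz j h))
    · exact (differentiableAt_apply j z).zpow (Or.inr h)
  exact (HasFDerivAt.finsetProd fun j _ => (h j).hasFDerivAt).differentiableAt

/-- Near a point off the coordinate hyperplanes, the torus coefficient is a multiple of the
monomial. -/
theorem torusCoeff_eventually_eq {R : Set (Fin n → ℂ)} (hRo : IsOpen R) (hR : IsReinhardt R)
    {f : (Fin n → ℂ) → ℂ} (hf : DifferentiableOn ℂ f R) (α : Fin n → ℤ) {z₀ : Fin n → ℂ}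
    (hz₀ : z₀ ∈ R) (h0 : ∀ j, z₀ j ≠ 0) :
    ∀ᶠ z in 𝓝 z₀, torusCoeff f α z =
      torusCoeff f α z₀ / laurentMonomial α z₀ * laurentMonomial α z := by
  obtain ⟨ε, hε, hball⟩ : ∃ ε > 0, Metric.ball z₀ ε ⊆ R ∩ {z | ∀ j, z j ≠ 0} := by
    refine Metric.isOpen_iff.1 (hRo.inter ?_) z₀ ⟨hz₀, h0⟩
    rw [show {z : Fin n → ℂ | ∀ j, z j ≠ 0} = ⋂ j, {z | z j ≠ 0} by ext; simp]
    exact isOpen_iInter_of_finite fun j => isOpen_ne.preimage (continuous_apply j)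
  let h : (Fin n → ℂ) → ℂ := fun z => torusCoeff f α z / laurentMonomial α z
  have hinv : ∀ t z, (∀ j, z j ≠ 0) → h (rot t z) = h z := by
    intro t z hz
    simp only [h, torusCoeff_rot, laurentMonomial_rot]
    refine mul_div_mul_left _ _ ?_
    have := norm_mFourier_apply α t
    intro h0
    simp [h0] at this
  have hupd : ∀ z ∈ Metric.ball z₀ ε, ∀ j, ∀ ζ ∈ Metric.ball (z₀ j) ε,
      Function.update z j ζ ∈ Metric.ball z₀ ε := by
    intro z hz j ζ hζ
    rw [Metric.mem_ball, dist_pi_lt_iff hε] at hz ⊢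
    intro i
    by_cases hij : i = j
    · subst hij; simpa using hζ
    · simpa [hij] using hz i
  have hstep : ∀ z ∈ Metric.ball z₀ ε, ∀ j, ∀ ζ ∈ Metric.ball (z₀ j) ε,
      h (Function.update z j ζ) = h z := by
    intro z hz j ζ hζ
    have hzj : z j ∈ Metric.ball (z₀ j) ε := (dist_le_pi_dist z z₀ j).trans_lt hz
    have := eq_of_rotation_invariant (φ := fun ζ => h (Function.update z j ζ)) (c := z₀ j) (ε := ε)
      ?_ ?_ ?_ hζ hzj
    · simpa using this
    · intro ζ hζ
      have hu : ∀ ζ : ℂ, Function.update z j ζ =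
          Function.update z j 0 + ζ • (Pi.single j 1 : Fin n → ℂ) := by
        intro ζ
        ext i
        by_cases hij : i = j
        · subst hij; simp
        · simp [hij]
      have hmem := hball (hupd z hz j ζ hζ)
      have h1 : DifferentiableAt ℂ (fun ζ => torusCoeff f α (Function.update z j ζ)) ζ := by
        have := torusCoeff_holomorphicOnLines hRo hR hf α (Function.update z j 0)
          (Pi.single j 1 : Fin n → ℂ) ζ (by rw [← hu]; exact hmem.1)
        simpa only [← hu] using this
      have h2 : DifferentiableAt ℂ (fun ζ => laurentMonomial α (Function.update z j ζ)) ζ := by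
        have h3 : DifferentiableAt ℂ (fun ζ : ℂ => Function.update z j ζ) ζ := by
          rw [funext hu]; fun_prop
        exact (differentiableAt_laurentMonomial α fun j _ => hmem.2 j).comp ζ h3
      exact (h1.div h2 (laurentMonomial_ne_zero α hmem.2)).differentiableWithinAt
    · intro ζ hζ
      simpa using (hball (hupd z hz j ζ hζ)).2 j
    · intro θ ζ hζ _
      obtain ⟨t, ht⟩ := exists_rot_eq_update θ (Function.update z j ζ) j
      simp only [Function.update_self, Function.update_idem] at ht
      rw [← ht, hinv _ _ (hball (hupd z hz j ζ hζ)).2]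
  filter_upwards [Metric.ball_mem_nhds z₀ hε] with z hz
  -- The sup-norm ball is a polydisc, so one can move from `z₀` to `z` one coordinate at a time
  -- without leaving it.
  have hall : ∀ s : Finset (Fin n), s.piecewise z z₀ ∈ Metric.ball z₀ ε ∧
      h (s.piecewise z z₀) = h z₀ := by
    intro s
    induction s using Finset.induction_on with
    | empty => simp [hε]
    | insert j s hj ih =>
      have hzj : z j ∈ Metric.ball (z₀ j) ε := (dist_le_pi_dist z z₀ j).trans_lt hz
      rw [Finset.piecewise_insert]
      exact ⟨hupd _ ih.1 j _ hzj, (hstep _ ih.1 j _ hzj).trans ih.2⟩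
  have hfin : h z = h z₀ := by simpa using (hall Finset.univ).2
  change _ = h z₀ * _
  rw [← hfin, div_mul_cancel₀ _ (laurentMonomial_ne_zero α (hball hz).2)]

/-- The torus coefficients of a holomorphic function on a Reinhardt domain are monomials, with
vanishing coefficient if the monomial is singular on the domain. -/
theorem exists_torusCoeff_eq {R : Set (Fin n → ℂ)} (hR : IsBoundedReinhardtDomain R)
    {f : (Fin n → ℂ) → ℂ} (hf : DifferentiableOn ℂ f R) :
    ∃ a : (Fin n → ℤ) → ℂ, (∀ α, a α ≠ 0 → ∀ z ∈ R, ∀ j, α j < 0 → z j ≠ 0) ∧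
      ∀ α, ∀ z ∈ R, torusCoeff f α z = a α * laurentMonomial α z := by
  obtain ⟨y, hy⟩ := hR.isConnected.nonempty
  obtain ⟨z₀, hz₀, hz₀'⟩ := exists_mem_forall_ne_zero hR.isOpen hy
  refine ⟨fun α => torusCoeff f α z₀ / laurentMonomial α z₀, ?_⟩
  rw [← forall_and]
  intro α
  set a := torusCoeff f α z₀ / laurentMonomial α z₀
  have hev := torusCoeff_eventually_eq hR.isOpen hR.isReinhardt hf α hz₀ hz₀'
  have hline := torusCoeff_holomorphicOnLines hR.isOpen hR.isReinhardt hf α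
  have hsplit : ∀ z : Fin n → ℂ, (∀ j, α j < 0 → z j ≠ 0) →
      laurentMonomial α z * ∏ j, z j ^ (-α j).toNat = ∏ j, z j ^ (α j).toNat := by
    intro z hz
    rw [laurentMonomial, ← Finset.prod_mul_distrib]
    refine Finset.prod_congr rfl fun j _ => ?_
    rcases lt_or_ge (α j) 0 with h | h
    · obtain ⟨m, hm⟩ := Int.eq_ofNat_of_zero_le (neg_nonneg.2 h.le)
      have h' : α j = -(m : ℤ) := by omega
      simp [h', hz j h]
    · obtain ⟨m, hm⟩ := Int.eq_ofNat_of_zero_le h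
      simp [hm]
  -- Clearing denominators makes both sides holomorphic along lines before the monomial is known to
  -- be regular on `R`.
  have hid : ∀ z ∈ R, torusCoeff f α z * ∏ j, z j ^ (-α j).toNat =
      a * ∏ j, z j ^ (α j).toNat := by
    intro z hz
    rw [← sub_eq_zero]
    have hg : HolomorphicOnLines (fun z : Fin n → ℂ => torusCoeff f α z *
        ∏ j, z j ^ (-α j).toNat - a * ∏ j, z j ^ (α j).toNat) R := by
      intro w v l hl
      have h1 := hline w v l hl
      simp only [Pi.add_apply, Pi.smul_apply, smul_eq_mul]
      refine (h1.mul ?_).sub (DifferentiableAt.const_mul ?_ _) <;>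
      exact DifferentiableAt.fun_finsetProd fun j _ => by fun_prop
    refine hg.eq_zero_of_preconnected hR.isOpen hR.isConnected.isPreconnected hz₀ ?_ hz
    have hne : ∀ᶠ z : Fin n → ℂ in 𝓝 z₀, ∀ j, z j ≠ 0 := by
      rw [eventually_all]
      exact fun j => (continuous_apply j).continuousAt.eventually_ne (hz₀' j)
    filter_upwards [hev, hne] with z hz1 hz2
    rw [hz1, mul_assoc, hsplit z fun j _ => hz2 j, sub_self]
  have hwell : a ≠ 0 → ∀ z ∈ R, ∀ j, α j < 0 → z j ≠ 0 := by
    intro ha z hz j hj hzj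
    obtain ⟨ε, hε, hball⟩ := Metric.nhds_basis_closedBall.mem_iff.1 (hR.isOpen.mem_nhds hz)
    -- Only the `j`-th coordinate of `w` vanishes: the left side of `hid` is then zero, while the
    -- right side is `a` times a nonzero product.
    let w : Fin n → ℂ := fun i => if i = j then 0 else if z i = 0 then (ε : ℂ) else z i
    have hw : w ∈ R := by
      refine hball ?_
      rw [Metric.mem_closedBall, dist_pi_le_iff hε.le]
      intro i
      by_cases hij : i = j
      · subst hij; simp [w, hzj, hε.le]
      · by_cases hzi : z i = 0
        · simp [w, hij, hzi, abs_of_pos hε]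
        · simp [w, hij, hzi, hε.le]
    have h1 := hid w hw
    have h2 : ∏ i, w i ^ (-α i).toNat = 0 := by
      refine Finset.prod_eq_zero (Finset.mem_univ j) ?_
      have : (-α j).toNat ≠ 0 := by omega
      simp [w, this]
    rw [h2, mul_zero] at h1
    refine (mul_ne_zero ha (Finset.prod_ne_zero_iff.2 fun i _ => ?_)) h1.symm
    by_cases hij : i = j
    · subst hij
      have : (α i).toNat = 0 := by omega
      simp [this]
    · refine pow_ne_zero _ ?_
      by_cases hzi : z i = 0
      · simp [w, hij, hzi, hε.ne']
      · simp [w, hij, hzi]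
  refine ⟨hwell, fun z hz => ?_⟩
  by_cases ha : a = 0
  · change _ = a * _
    rw [ha, zero_mul]
    refine hline.eq_zero_of_preconnected hR.isOpen hR.isConnected.isPreconnected hz₀ ?_ hz
    filter_upwards [hev] with z hz1
    rw [hz1]
    change a * _ = 0
    rw [ha, zero_mul]
  · have h1 := hid z hz
    have h2 := hsplit z (hwell ha z hz)
    have h3 : ∏ j, z j ^ (-α j).toNat ≠ 0 := by
      refine Finset.prod_ne_zero_iff.2 fun j _ => ?_
      rcases lt_or_ge (α j) 0 with h | h
      · exact pow_ne_zero _ (hwell ha z hz j h)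
      · have : (-α j).toNat = 0 := by omega
        simp [this]
    refine mul_right_cancel₀ h3 ?_
    change _ = a * _ * _
    rw [h1, ← h2, mul_assoc]

/-! ### Normal convergence of the Laurent series. -/

theorem summable_pow_natAbs {ρ : ℝ} (h0 : 0 ≤ ρ) (h1 : ρ < 1) :
    Summable fun m : ℤ => ρ ^ m.natAbs := by
  refine Summable.of_nat_of_neg ?_ ?_ <;>
  simpa using summable_geometric_of_lt_one h0 h1

theorem summable_prod_apply {u : ℤ → ℝ} (hu : Summable u) (h0 : ∀ m, 0 ≤ u m) :
    Summable fun α : Fin n → ℤ => ∏ j, u (α j) := by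
  classical
  refine summable_of_sum_le (c := ∏ _j : Fin n, ∑' m, u m)
    (fun α => Finset.prod_nonneg fun j _ => h0 _) fun s => ?_
  let S : Fin n → Finset ℤ := fun j => s.image fun α => α j
  calc ∑ α ∈ s, ∏ j, u (α j) ≤ ∑ α ∈ Fintype.piFinset S, ∏ j, u (α j) := by
        refine Finset.sum_le_sum_of_subset_of_nonneg (fun α hα => ?_)
          fun α _ _ => Finset.prod_nonneg fun j _ => h0 _
        exact Fintype.mem_piFinset.2 fun j => Finset.mem_image_of_mem (fun α => α j) hα
    _ = ∏ j, ∑ m ∈ S j, u m := (Finset.prod_univ_sum S fun _ m => u m).symm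
    _ ≤ _ := Finset.prod_le_prod (fun j _ => Finset.sum_nonneg fun m _ => h0 m)
        fun j _ => hu.sum_le_tsum _ fun m _ => h0 m

/-- Geometric comparison of the powers near a point with those at a suitable nearby point. -/
theorem exists_norm_zpow_le (z₀ : ℂ) {ε B : ℝ} (hε : 0 < ε) (hB : ‖z₀‖ + ε ≤ B) (m : ℤ)
    (hm : m < 0 → ε < ‖z₀‖) :
    ∃ w : ℂ, ‖w - z₀‖ ≤ ε ∧ ∀ z, ‖z - z₀‖ < ε / 2 →
      ‖z ^ m‖ ≤ (1 - ε / (2 * B)) ^ m.natAbs * ‖w ^ m‖ := by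
  have hB0 : 0 < B := by linarith [norm_nonneg z₀]
  have hρ0 : 0 ≤ 1 - ε / (2 * B) := by
    rw [sub_nonneg, div_le_one (by positivity)]; linarith [norm_nonneg z₀]
  rcases lt_or_ge m 0 with h | h
  · have hz := hm h
    have hz0 : 0 < ‖z₀‖ := by linarith
    obtain ⟨k, hk⟩ := Int.eq_ofNat_of_zero_le (neg_nonneg.2 h.le)
    obtain rfl : m = -(k : ℤ) := by omega
    have hwn : ‖((1 - ε / ‖z₀‖ : ℝ) : ℂ) * z₀‖ = ‖z₀‖ - ε := by
      rw [norm_mul, Complex.norm_real, Real.norm_of_nonneg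
        (by rw [sub_nonneg, div_le_one hz0]; exact hz.le)]
      field_simp
    -- For a negative exponent the comparison point moves radially inwards by `ε`, staying off zero;
    -- for a nonnegative one it moves outwards.
    refine ⟨((1 - ε / ‖z₀‖ : ℝ) : ℂ) * z₀, ?_, fun z hzz => ?_⟩
    · have : ((1 - ε / ‖z₀‖ : ℝ) : ℂ) * z₀ - z₀ = ((-(ε / ‖z₀‖) : ℝ) : ℂ) * z₀ := by
        push_cast; ring
      rw [this, norm_mul, Complex.norm_real, norm_neg, Real.norm_of_nonneg (by positivity)]
      field_simp
      exact le_rfl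
    · have hzn : ‖z₀‖ - ε / 2 < ‖z‖ := by
        have := norm_sub_norm_le z₀ z
        rw [norm_sub_rev] at this
        linarith
      have hzp : 0 < ‖z‖ := by linarith
      simp only [zpow_neg, zpow_natCast, norm_inv, norm_pow, Int.natAbs_neg, Int.natAbs_natCast]
      rw [hwn, ← div_eq_mul_inv, le_div_iff₀ (pow_pos (by linarith) _), inv_mul_eq_div,
        div_le_iff₀ (by positivity), ← mul_pow]
      refine pow_le_pow_left₀ (by linarith) ?_ _
      have h1 : (‖z₀‖ - ε) ≤ (1 - ε / (2 * B)) * (‖z₀‖ - ε / 2) := by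
        have : ε / (2 * B) * (‖z₀‖ - ε / 2) ≤ ε / (2 * B) * B := by gcongr; linarith
        have h2 : ε / (2 * B) * B = ε / 2 := by field_simp
        linarith
      exact h1.trans (by gcongr)
  · obtain ⟨k, rfl⟩ := Int.eq_ofNat_of_zero_le h
    obtain ⟨w, hw1, hw2⟩ : ∃ w : ℂ, ‖w - z₀‖ ≤ ε ∧ ‖w‖ = ‖z₀‖ + ε := by
      by_cases hz : z₀ = 0
      · exact ⟨(ε : ℂ), by simp [hz, abs_of_pos hε], by simp [hz, abs_of_pos hε]⟩
      · have hz0 : 0 < ‖z₀‖ := norm_pos_iff.2 hz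
        refine ⟨((1 + ε / ‖z₀‖ : ℝ) : ℂ) * z₀, ?_, ?_⟩
        · have : ((1 + ε / ‖z₀‖ : ℝ) : ℂ) * z₀ - z₀ = ((ε / ‖z₀‖ : ℝ) : ℂ) * z₀ := by
            push_cast; ring
          rw [this, norm_mul, Complex.norm_real, Real.norm_of_nonneg (by positivity)]
          field_simp
          exact le_rfl
        · rw [norm_mul, Complex.norm_real, Real.norm_of_nonneg (by positivity)]
          field_simp
    refine ⟨w, hw1, fun z hzz => ?_⟩
    simp only [zpow_natCast, norm_pow, Int.natAbs_natCast]
    rw [hw2, ← mul_pow]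
    refine pow_le_pow_left₀ (norm_nonneg _) ?_ _
    have h0 : ‖z‖ ≤ ‖z₀‖ + ε / 2 := by
      have := norm_sub_norm_le z z₀
      linarith
    have : ε / (2 * B) * (‖z₀‖ + ε) ≤ ε / (2 * B) * B := by gcongr
    have h2 : ε / (2 * B) * B = ε / 2 := by field_simp
    linarith

/-- Locally uniform geometric bounds for the terms of the Laurent series. -/
theorem exists_summable_bound_near {R : Set (Fin n → ℂ)} (hR : IsBoundedReinhardtDomain R)
    {f : (Fin n → ℂ) → ℂ} (hf : ContinuousOn f R) {a : (Fin n → ℤ) → ℂ}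
    (ha : ∀ α, a α ≠ 0 → ∀ z ∈ R, ∀ j, α j < 0 → z j ≠ 0)
    (hcoeff : ∀ α, ∀ z ∈ R, torusCoeff f α z = a α * laurentMonomial α z)
    {z₀ : Fin n → ℂ} (hz₀ : z₀ ∈ R) :
    ∃ V ∈ 𝓝 z₀, ∃ u : (Fin n → ℤ) → ℝ, Summable u ∧
      ∀ α, ∀ z ∈ V, ‖a α * laurentMonomial α z‖ ≤ u α := by
  obtain ⟨ε, hε, hball, hεz⟩ : ∃ ε > 0, Metric.closedBall z₀ ε ⊆ R ∧
      ∀ j, z₀ j ≠ 0 → ε < ‖z₀ j‖ := by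
    have h1 : ∀ᶠ ε : ℝ in 𝓝[>] 0, Metric.closedBall z₀ ε ⊆ R := by
      obtain ⟨δ, hδ, h⟩ := Metric.nhds_basis_closedBall.mem_iff.1 (hR.isOpen.mem_nhds hz₀)
      filter_upwards [nhdsWithin_le_nhds (Iio_mem_nhds hδ)] with ε hε
      exact (Metric.closedBall_subset_closedBall (le_of_lt hε)).trans h
    have h2 : ∀ᶠ ε : ℝ in 𝓝[>] 0, ∀ j, z₀ j ≠ 0 → ε < ‖z₀ j‖ := by
      rw [eventually_all]
      intro j
      by_cases hj : z₀ j = 0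
      · simp [hj]
      · filter_upwards [nhdsWithin_le_nhds (Iio_mem_nhds (norm_pos_iff.2 hj))] with ε hε _
        exact hε
    obtain ⟨ε, ⟨h, h'⟩, h''⟩ := ((h1.and h2).and self_mem_nhdsWithin).exists
    exact ⟨ε, h'', h, h'⟩
  have hcont : ContinuousOn (fun q : UnitAddTorus (Fin n) × (Fin n → ℂ) => f (rot q.1 q.2))
      (Set.univ ×ˢ Metric.closedBall z₀ ε) :=
    hf.comp continuous_uncurry_rot.continuousOn fun q hq => hR.isReinhardt.rot_mem _ (hball hq.2)
  obtain ⟨M, hM⟩ := (isCompact_univ.prod (isCompact_closedBall z₀ ε)).exists_bound_of_continuousOn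
    hcont
  have hMc : ∀ α, ∀ w ∈ Metric.closedBall z₀ ε, ‖torusCoeff f α w‖ ≤ M := by
    intro α w hw
    rw [torusCoeff_eq_integral]
    have := norm_integral_le_of_norm_le_const (μ := torusHaar n) (C := M)
      (f := fun t => mFourier (-α) t * f (rot t w)) (Eventually.of_forall fun t => by
        rw [norm_mul, norm_mFourier_apply, one_mul]; exact hM (t, w) ⟨Set.mem_univ _, hw⟩)
    simpa using this
  have hM0 : 0 ≤ M := (norm_nonneg _).trans (hMc 0 z₀ (by simp [hε.le]))
  set B := ‖z₀‖ + ε with hB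
  have hB0 : 0 < B := by positivity
  set ρ := 1 - ε / (2 * B) with hρ
  have hρ0 : 0 ≤ ρ := by
    rw [hρ, sub_nonneg, div_le_one (by positivity)]; linarith [norm_nonneg z₀]
  have hρ1 : ρ < 1 := by
    have : 0 < ε / (2 * B) := by positivity
    linarith
  refine ⟨Metric.ball z₀ (ε / 2), Metric.ball_mem_nhds _ (by positivity),
    fun α => M * ∏ j, ρ ^ (α j).natAbs,
    (summable_prod_apply (summable_pow_natAbs hρ0 hρ1) fun m => by positivity).mul_left M,
    fun α z hz => ?_⟩
  by_cases haα : a α = 0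
  · rw [haα, zero_mul, norm_zero]
    positivity
  -- Where `α j < 0`, a nonzero `a α` forces `z₀ j ≠ 0`, so `ε < ‖z₀ j‖`. The point `w` depends on
  -- `α` but stays in the closed ball, where `M` bounds every coefficient.
  · choose w hw1 hw2 using fun j => exists_norm_zpow_le (z₀ j) (B := B) hε
      (by rw [hB]; linarith [norm_le_pi_norm z₀ j]) (α j)
      fun h => hεz j (ha α haα z₀ hz₀ j h)
    have hwb : w ∈ Metric.closedBall z₀ ε := by
      rw [Metric.mem_closedBall, dist_pi_le_iff hε.le]
      exact fun j => by rw [dist_eq_norm]; exact hw1 j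
    have h1 : ‖laurentMonomial α z‖ ≤ (∏ j, ρ ^ (α j).natAbs) * ‖laurentMonomial α w‖ := by
      simp only [laurentMonomial, norm_prod]
      rw [← Finset.prod_mul_distrib]
      refine Finset.prod_le_prod (fun j _ => norm_nonneg _) fun j _ => hw2 j _ ?_
      rw [← dist_eq_norm]
      exact (dist_le_pi_dist z z₀ j).trans_lt hz
    have h2 := hMc α w hwb
    rw [hcoeff α w (hball hwb), norm_mul] at h2
    rw [norm_mul]
    calc ‖a α‖ * ‖laurentMonomial α z‖
        ≤ ‖a α‖ * ((∏ j, ρ ^ (α j).natAbs) * ‖laurentMonomial α w‖) := by gcongr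
      _ = (‖a α‖ * ‖laurentMonomial α w‖) * ∏ j, ρ ^ (α j).natAbs := by ring
      _ ≤ M * ∏ j, ρ ^ (α j).natAbs :=
        mul_le_mul_of_nonneg_right h2 (Finset.prod_nonneg fun j _ => pow_nonneg hρ0 _)

theorem exists_summable_bound_on_compact {R : Set (Fin n → ℂ)} {F : (Fin n → ℤ) → (Fin n → ℂ) → ℂ}
    (h : ∀ z₀ ∈ R, ∃ V ∈ 𝓝 z₀, ∃ u : (Fin n → ℤ) → ℝ, Summable u ∧ ∀ α, ∀ z ∈ V, ‖F α z‖ ≤ u α)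
    {K : Set (Fin n → ℂ)} (hK : IsCompact K) (hKR : K ⊆ R) :
    ∃ u : (Fin n → ℤ) → ℝ, Summable u ∧ ∀ α, ∀ z ∈ K, ‖F α z‖ ≤ u α := by
  refine hK.induction_on (p := fun K => ∃ u : (Fin n → ℤ) → ℝ, Summable u ∧
    ∀ α, ∀ z ∈ K, ‖F α z‖ ≤ u α) ⟨0, summable_zero, by simp⟩ ?_ ?_ ?_
  · rintro s t hst ⟨u, hu, h⟩
    exact ⟨u, hu, fun α z hz => h α z (hst hz)⟩
  · rintro s t ⟨u, hu, h⟩ ⟨v, hv, h'⟩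
    refine ⟨fun α => |u α| + |v α|, hu.abs.add hv.abs, fun α z hz => ?_⟩
    rcases hz with hz | hz
    · linarith [h α z hz, le_abs_self (u α), abs_nonneg (v α)]
    · linarith [h' α z hz, le_abs_self (v α), abs_nonneg (u α)]
  · intro x hx
    obtain ⟨V, hV, u, hu, h⟩ := h x (hKR hx)
    exact ⟨V, mem_nhdsWithin_of_mem_nhds hV, u, hu, h⟩

/-- Uniform convergence is the M-test. The sum is identified with `f z` by evaluating at `t = 0` the
Fourier series of `t ↦ f (rot t z)`, whose coefficients are summable. -/
theorem isLaurentExpansion_of_torusCoeff_eq {R : Set (Fin n → ℂ)}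
    (hR : IsBoundedReinhardtDomain R) {f : (Fin n → ℂ) → ℂ} (hf : ContinuousOn f R)
    {a : (Fin n → ℤ) → ℂ} (ha : ∀ α, a α ≠ 0 → ∀ z ∈ R, ∀ j, α j < 0 → z j ≠ 0)
    (hcoeff : ∀ α, ∀ z ∈ R, torusCoeff f α z = a α * laurentMonomial α z) :
    IsLaurentExpansion R f a := by
  refine ⟨ha, fun K hKR hK => ?_⟩
  have hnear := fun z₀ (hz₀ : z₀ ∈ R) => exists_summable_bound_near hR hf ha hcoeff hz₀
  obtain ⟨u, hu, hbound⟩ := exists_summable_bound_on_compact hnear hK hKR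
  have h1 := HasSumUniformlyOn.of_norm_le_summable hu hbound
  refine h1.congr_right ?_
  intro z hz
  have hc : Continuous fun t => f (rot t z) :=
    hf.comp_continuous (continuous_uncurry_rot.comp (continuous_id.prodMk continuous_const))
      fun t => hR.isReinhardt.rot_mem t (hKR hz)
  have hs : Summable (mFourierCoeff (⟨fun t => f (rot t z), hc⟩ : C(UnitAddTorus (Fin n), ℂ))) := by
    refine Summable.of_norm_bounded hu fun α => ?_
    have := hbound α z hz
    rwa [← hcoeff α z (hKR hz)] at this
  have h2 := hasSum_mFourier_series_apply_of_summable hs 0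
  have h3 : HasSum (fun α => a α * laurentMonomial α z) (f z) := by
    convert h2 using 1
    · ext α
      rw [← hcoeff α z (hKR hz)]
      have : (mFourier α (0 : UnitAddTorus (Fin n)) : ℂ) = 1 := by simp [mFourier]
      rw [this]
      simp [torusCoeff]
    · simp [rot_zero]
  exact h3.tsum_eq

/-! ### Orthogonality and uniqueness of the expansion. -/

theorem integral_mFourier_mul_mFourier {α β : Fin n → ℤ} (h : α ≠ β) :
    ∫ t, (mFourier (-α) t : ℂ) * mFourier β t ∂torusHaar n = 0 := by
  obtain ⟨j, hj⟩ := Function.ne_iff.1 h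
  have h1 : ∀ t, (mFourier (-α) t : ℂ) * mFourier β t =
      ∏ i, (fourier (-α i) (t i) * fourier (β i) (t i) : ℂ) := by
    intro t
    simp only [mFourier, ContinuousMap.coe_mk, Finset.prod_mul_distrib, Pi.neg_apply]
  simp_rw [h1]
  rw [integral_fintype_prod_eq_prod (fun i t => (fourier (-α i) t * fourier (β i) t : ℂ))]
  refine Finset.prod_eq_zero (Finset.mem_univ j) ?_
  rw [← integral_fourier_mul_conj_fourier (Ne.symm hj)]
  refine integral_congr_ae (Eventually.of_forall fun t => ?_)
  simp only [fourier_neg, mul_comm]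

/-- The coefficients of a Laurent expansion are given by the torus integrals. -/
theorem IsLaurentExpansion.torusCoeff_eq {R : Set (Fin n → ℂ)} (hR : IsReinhardt R)
    {f : (Fin n → ℂ) → ℂ} (hf : ContinuousOn f R) {b : (Fin n → ℤ) → ℂ}
    (hb : IsLaurentExpansion R f b) (α : Fin n → ℤ) {z : Fin n → ℂ} (hz : z ∈ R) :
    torusCoeff f α z = b α * laurentMonomial α z := by
  have hcr : Continuous fun t => rot t z :=
    continuous_uncurry_rot.comp (continuous_id.prodMk continuous_const)
  have hc : Continuous fun t => f (rot t z) :=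
    hf.comp_continuous hcr fun t => hR.rot_mem t hz
  have hK := hb.hasSum (Set.range fun t => rot t z)
    (by rintro _ ⟨t, rfl⟩; exact hR.rot_mem t hz) (isCompact_range hcr)
  rw [hasSumUniformlyOn_iff_tendstoUniformlyOn, Metric.tendstoUniformlyOn_iff] at hK
  rw [← sub_eq_zero, ← norm_le_zero_iff]
  refine le_of_forall_pos_le_add fun ε hε => ?_
  rw [zero_add]
  -- A finite partial sum that contains `α` and is within `ε` of `f` on the whole orbit; its torus
  -- integral is exactly the `α` term.
  obtain ⟨s, hs, hαs⟩ := ((hK ε hε).and (eventually_ge_atTop {α})).exists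
  have hint : ∀ g : UnitAddTorus (Fin n) → ℂ, Continuous g → Integrable g (torusHaar n) :=
    fun g hg => hg.integrable_of_hasCompactSupport (HasCompactSupport.of_compactSpace _)
  have hP : ∫ t, mFourier (-α) t * ∑ β ∈ s, b β * laurentMonomial β (rot t z) ∂torusHaar n =
      b α * laurentMonomial α z := by
    simp only [Finset.mul_sum, laurentMonomial_rot]
    have h1 : ∀ t : UnitAddTorus (Fin n), ∀ β, mFourier (-α) t * (b β *
        (mFourier β t * laurentMonomial β z)) =
        (b β * laurentMonomial β z) * (mFourier (-α) t * mFourier β t) := by intros; ring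
    simp_rw [h1]
    rw [integral_finsetSum _ fun β _ => hint _ (by fun_prop)]
    simp_rw [integral_const_mul]
    rw [Finset.sum_eq_single α (fun β _ hβ => by
      rw [integral_mFourier_mul_mFourier hβ.symm, mul_zero])
      fun h => absurd (hαs (Finset.mem_singleton_self α)) h]
    have h2 : ∀ t : UnitAddTorus (Fin n), (mFourier (-α) t : ℂ) * mFourier α t = 1 := by
      intro t
      rw [← mFourier_add]; simp [mFourier_zero]
    simp [h2]
  have hmc : Continuous fun t : UnitAddTorus (Fin n) => (mFourier (-α) t : ℂ) :=
    ContinuousMap.continuous _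
  have hcs : Continuous fun t => ∑ β ∈ s, b β * laurentMonomial β (rot t z) := by
    simp only [laurentMonomial_rot]
    fun_prop
  have hi1 : Integrable (fun t => mFourier (-α) t * f (rot t z)) (torusHaar n) :=
    hint _ (hmc.mul hc)
  have hi2 : Integrable (fun t => mFourier (-α) t * ∑ β ∈ s, b β * laurentMonomial β (rot t z))
      (torusHaar n) := hint _ (hmc.mul hcs)
  rw [← hP, torusCoeff_eq_integral, ← integral_sub hi1 hi2]
  have := norm_integral_le_of_norm_le_const (μ := torusHaar n) (C := ε)
    (f := fun t => mFourier (-α) t * f (rot t z) -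
      mFourier (-α) t * ∑ β ∈ s, b β * laurentMonomial β (rot t z)) (Eventually.of_forall fun t => by
      rw [← mul_sub, norm_mul, norm_mFourier_apply, one_mul, ← dist_eq_norm]
      exact (hs (rot t z) ⟨t, rfl⟩).le)
  simpa using this

/-- A holomorphic function on a bounded Reinhardt domain has a unique Laurent expansion. -/
theorem exists_unique_laurentExpansion {R : Set (Fin n → ℂ)} (hR : IsBoundedReinhardtDomain R)
    {f : (Fin n → ℂ) → ℂ} (hf : DifferentiableOn ℂ f R) :
    ∃ a, IsLaurentExpansion R f a ∧ (∀ b, IsLaurentExpansion R f b → b = a) ∧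
      ∀ z₀ ∈ R, ∃ V ∈ 𝓝 z₀, ∃ u : (Fin n → ℤ) → ℝ, Summable u ∧
        ∀ α, ∀ z ∈ V, ‖a α * laurentMonomial α z‖ ≤ u α := by
  obtain ⟨a, ha, hcoeff⟩ := exists_torusCoeff_eq hR hf
  refine ⟨a, isLaurentExpansion_of_torusCoeff_eq hR hf.continuousOn ha hcoeff, fun b hb => ?_,
    fun z₀ hz₀ => exists_summable_bound_near hR hf.continuousOn ha hcoeff hz₀⟩
  obtain ⟨y, hy⟩ := hR.isConnected.nonempty
  obtain ⟨z₀, hz₀, hz₀'⟩ := exists_mem_forall_ne_zero hR.isOpen hy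
  ext α
  refine mul_right_cancel₀ (laurentMonomial_ne_zero α hz₀') ?_
  rw [← hb.torusCoeff_eq hR.isReinhardt hf.continuousOn α hz₀, hcoeff α z₀ hz₀]

/-! ### Normally convergent series, truncation and averaging over circles. -/

/-- The Laurent series `∑ c_α z^α` consists of monomials that are regular on `R` and converges
normally on `R`. -/
structure NormallyConvergent (R : Set (Fin n → ℂ)) (c : (Fin n → ℤ) → ℂ) : Prop where
  wellDefined : ∀ α, c α ≠ 0 → ∀ z ∈ R, ∀ j, α j < 0 → z j ≠ 0
  bound : ∀ z₀ ∈ R, ∃ V ∈ 𝓝 z₀, ∃ u : (Fin n → ℤ) → ℝ, Summable u ∧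
    ∀ α, ∀ z ∈ V, ‖c α * laurentMonomial α z‖ ≤ u α

/-- The sum of a Laurent series on `R`, extended by zero. -/
noncomputable def laurentSum (R : Set (Fin n → ℂ)) (c : (Fin n → ℤ) → ℂ) : (Fin n → ℂ) → ℂ :=
  R.indicator fun z => ∑' α, c α * laurentMonomial α z

/-- The coefficients with `|α_j| ≤ N`. -/
noncomputable def truncate (j : Fin n) (N : ℕ) (c : (Fin n → ℤ) → ℂ) (α : Fin n → ℤ) : ℂ :=
  if |α j| ≤ (N : ℤ) then c α else 0

theorem norm_truncate_le (j : Fin n) (N : ℕ) (c : (Fin n → ℤ) → ℂ) (α : Fin n → ℤ) :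
    ‖truncate j N c α‖ ≤ ‖c α‖ := by
  unfold truncate
  split_ifs <;> simp

theorem measurePreserving_rot (t : UnitAddTorus (Fin n)) :
    MeasurePreserving (rot t) (volume : Measure (Fin n → ℂ)) volume := by
  refine volume_preserving_pi (f := fun j z => fourier 1 (t j) * z) fun j => ?_
  have h : (fun z : ℂ => fourier 1 (t j) * z) = rotation (AddCircle.toCircle (t j)) := by
    ext z
    rw [rotation_apply, fourier_one]
  rw [h]
  exact (rotation (AddCircle.toCircle (t j))).measurePreserving

/-- The rotation of the `j`-th coordinate. -/
noncomputable def rotCoord (j : Fin n) (t : UnitAddCircle) (z : Fin n → ℂ) : Fin n → ℂ :=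
  rot (Pi.single j t) z

@[fun_prop]
theorem continuous_uncurry_rotCoord (j : Fin n) :
    Continuous fun q : UnitAddCircle × (Fin n → ℂ) => rotCoord j q.1 q.2 :=
  continuous_uncurry_rot.comp (((continuous_single j).comp continuous_fst).prodMk continuous_snd)

theorem laurentMonomial_rotCoord (j : Fin n) (α : Fin n → ℤ) (t : UnitAddCircle)
    (z : Fin n → ℂ) :
    laurentMonomial α (rotCoord j t z) = fourier (α j) t * laurentMonomial α z := by
  rw [rotCoord, laurentMonomial_rot]
  congr 1
  simp only [mFourier, ContinuousMap.coe_mk]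
  rw [Finset.prod_eq_single j]
  · simp
  · intro i _ hi
    simp [hi]
  · simp

theorem IsReinhardt.rotCoord_mem_iff {R : Set (Fin n → ℂ)} (hR : IsReinhardt R) (j : Fin n)
    (t : UnitAddCircle) {z : Fin n → ℂ} : rotCoord j t z ∈ R ↔ z ∈ R := by
  refine ⟨fun h => ?_, fun h => hR.rot_mem _ h⟩
  have := hR.rot_mem (-Pi.single j t) h
  rwa [rotCoord, ← rot_add, neg_add_cancel, rot_zero] at this

/-- Tonelli, rotation invariance of volume and total mass one of Haar measure. This replaces polar
coordinates when passing from circles to the domain. -/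
theorem lintegral_eq_lintegral_rotCoord (j : Fin n) {G : (Fin n → ℂ) → ℝ≥0∞} (hG : Measurable G) :
    ∫⁻ z, G z = ∫⁻ z, ∫⁻ t, G (rotCoord j t z) ∂haarAddCircle := by
  have hm : Measurable (Function.uncurry fun (z : Fin n → ℂ) (t : UnitAddCircle) =>
      G (rotCoord j t z)) :=
    hG.comp (((continuous_uncurry_rotCoord j).comp continuous_swap).measurable)
  rw [lintegral_lintegral_swap hm.aemeasurable]
  have h1 : ∀ t, ∫⁻ z, G (rotCoord j t z) = ∫⁻ z, G z := fun t =>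
    (measurePreserving_rot (Pi.single j t)).lintegral_comp hG
  simp [h1]

theorem eLpNorm_rpow_eq_lintegral {X : Type*} [MeasurableSpace X] (μ : Measure X) {p : ℝ≥0∞}
    (hp0 : p ≠ 0) (hp : p ≠ ∞) (f : X → ℂ) :
    eLpNorm f p μ ^ p.toReal = ∫⁻ x, ‖f x‖ₑ ^ p.toReal ∂μ := by
  rw [eLpNorm_eq_lintegral_rpow_enorm_toReal hp0 hp, ← ENNReal.rpow_mul,
    one_div_mul_cancel (ENNReal.toReal_pos hp0 hp).ne', ENNReal.rpow_one]

/-- The `L^p` norm is an average of `L^p` norms over circles in the `j`-th coordinate. -/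
theorem eLpNorm_rpow_eq_lintegral_rotCoord (j : Fin n) {p : ℝ≥0∞} (hp0 : p ≠ 0) (hp : p ≠ ∞)
    {g : (Fin n → ℂ) → ℂ} (hg : Measurable g) :
    eLpNorm g p volume ^ p.toReal =
      ∫⁻ z, eLpNorm (fun t => g (rotCoord j t z)) p haarAddCircle ^ p.toReal := by
  simp_rw [eLpNorm_rpow_eq_lintegral _ hp0 hp]
  exact lintegral_eq_lintegral_rotCoord j (hg.enorm.pow_const _)

theorem measurable_eLpNorm_rotCoord (j : Fin n) {p : ℝ≥0∞} (hp0 : p ≠ 0) (hp : p ≠ ∞)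
    {g : (Fin n → ℂ) → ℂ} (hg : Measurable g) :
    Measurable fun z => eLpNorm (fun t => g (rotCoord j t z)) p haarAddCircle ^ p.toReal := by
  simp_rw [eLpNorm_rpow_eq_lintegral _ hp0 hp]
  have hm : Measurable (Function.uncurry fun (z : Fin n → ℂ) (t : UnitAddCircle) =>
      ‖g (rotCoord j t z)‖ₑ ^ p.toReal) :=
    (hg.comp (((continuous_uncurry_rotCoord j).comp continuous_swap).measurable)).enorm.pow_const _
  exact hm.lintegral_prod_right'

namespace NormallyConvergent

variable {R : Set (Fin n → ℂ)} {c d : (Fin n → ℤ) → ℂ}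

/-- Truncations and their errors inherit convergence from this, with no fresh estimate. -/
theorem mono (hc : NormallyConvergent R c) (h : ∀ α, ‖d α‖ ≤ ‖c α‖) : NormallyConvergent R d := by
  refine ⟨fun α hα => hc.wellDefined α fun h0 => hα ?_, fun z₀ hz₀ => ?_⟩
  · simpa [h0] using h α
  · obtain ⟨V, hV, u, hu, hb⟩ := hc.bound z₀ hz₀
    refine ⟨V, hV, u, hu, fun α z hz => le_trans ?_ (hb α z hz)⟩
    rw [norm_mul, norm_mul]
    gcongr
    exact h α

theorem truncate (hc : NormallyConvergent R c) (j : Fin n) (N : ℕ) :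
    NormallyConvergent R (truncate j N c) :=
  hc.mono (norm_truncate_le j N c)

theorem summable (hc : NormallyConvergent R c) {z : Fin n → ℂ} (hz : z ∈ R) :
    Summable fun α => ‖c α * laurentMonomial α z‖ := by
  obtain ⟨V, hV, u, hu, hb⟩ := hc.bound z hz
  exact Summable.of_nonneg_of_le (fun α => norm_nonneg _) (fun α => hb α z (mem_of_mem_nhds hV)) hu

theorem continuousOn_laurentSum (hc : NormallyConvergent R c) :
    ContinuousOn (laurentSum R c) R := by
  intro z₀ hz₀
  obtain ⟨V, hV, u, hu, hb⟩ := hc.bound z₀ hz₀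
  have h1 : ContinuousOn (fun z => ∑' α, c α * laurentMonomial α z) (V ∩ R) := by
    refine continuousOn_tsum (fun α => ?_) hu fun α z hz => hb α z hz.1
    by_cases h0 : c α = 0
    · simp [h0, continuousOn_const]
    · exact fun z hz => (((differentiableAt_laurentMonomial α
        (hc.wellDefined α h0 z hz.2)).continuousAt).const_mul (c α)).continuousWithinAt
  have h2 : ContinuousWithinAt (fun z => ∑' α, c α * laurentMonomial α z) R z₀ := by
    have := h1 z₀ ⟨mem_of_mem_nhds hV, hz₀⟩
    rwa [Set.inter_comm, continuousWithinAt_inter hV] at this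
  exact h2.congr (fun z hz => Set.indicator_of_mem hz _) (Set.indicator_of_mem hz₀ _)

theorem measurable_laurentSum (hc : NormallyConvergent R c) (hR : IsOpen R) :
    Measurable (laurentSum R c) := by
  classical
  have h : laurentSum R c = R.piecewise (laurentSum R c) 0 := by
    ext z
    by_cases hz : z ∈ R <;> simp [laurentSum, hz]
  rw [h]
  exact hc.continuousOn_laurentSum.measurable_piecewise continuousOn_const hR.measurableSet

theorem laurentSum_add (hc : NormallyConvergent R c) (hd : NormallyConvergent R d) :
    laurentSum R (fun α => c α + d α) = laurentSum R c + laurentSum R d := by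
  ext z
  by_cases hz : z ∈ R
  · simp only [laurentSum, Pi.add_apply, Set.indicator_of_mem hz, add_mul]
    exact (hc.summable hz).of_norm.tsum_add (hd.summable hz).of_norm
  · simp [laurentSum, hz]

theorem laurentSum_rotCoord (hR : IsReinhardt R) (c : (Fin n → ℤ) → ℂ) (j : Fin n)
    {z : Fin n → ℂ} (hz : z ∈ R) (t : UnitAddCircle) :
    laurentSum R c (rotCoord j t z) = ∑' α, c α * laurentMonomial α z * fourier (α j) t := by
  rw [laurentSum, Set.indicator_of_mem ((hR.rotCoord_mem_iff j t).2 hz)]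
  refine tsum_congr fun α => ?_
  rw [laurentMonomial_rotCoord]
  ring

theorem laurentSum_rotCoord_of_notMem (hR : IsReinhardt R) (c : (Fin n → ℤ) → ℂ) (j : Fin n)
    {z : Fin n → ℂ} (hz : z ∉ R) (t : UnitAddCircle) :
    laurentSum R c (rotCoord j t z) = 0 := by
  rw [laurentSum, Set.indicator_of_notMem (mt (hR.rotCoord_mem_iff j t).1 hz)]

theorem aestronglyMeasurable_rotCoord (hc : NormallyConvergent R c) (hRo : IsOpen R) (j : Fin n)
    (z : Fin n → ℂ) :
    AEStronglyMeasurable (fun t => laurentSum R c (rotCoord j t z)) haarAddCircle :=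
  ((hc.measurable_laurentSum hRo).comp ((continuous_uncurry_rotCoord j).comp
    (continuous_id.prodMk continuous_const)).measurable).aestronglyMeasurable

end NormallyConvergent

/-! ### Truncation in one coordinate. -/

/-- Uniform bounds for truncation in one coordinate, on circles and on `R`. -/
theorem exists_eLpNorm_truncate_le {p : ℝ≥0∞} (hp1 : 1 < p) (hp : p < ∞) :
    ∃ C : ℝ≥0∞, C ≠ ∞ ∧ ∀ {n : ℕ} {R : Set (Fin n → ℂ)}, IsOpen R → IsReinhardt R →
      ∀ (j : Fin n) (N : ℕ) {c : (Fin n → ℤ) → ℂ}, NormallyConvergent R c →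
        (∀ z, eLpNorm (fun t => laurentSum R (truncate j N c) (rotCoord j t z)) p haarAddCircle ≤
          C * eLpNorm (fun t => laurentSum R c (rotCoord j t z)) p haarAddCircle) ∧
        eLpNorm (laurentSum R (truncate j N c)) p volume ≤
          C * eLpNorm (laurentSum R c) p volume := by
  obtain ⟨C, hC, h⟩ := exists_eLpNorm_tsum_abs_le hp1 hp
  have hp0 : p ≠ 0 := (zero_lt_one.trans hp1).ne'
  have hq : 0 < p.toReal := ENNReal.toReal_pos hp0 hp.ne
  refine ⟨C, hC, fun {n R} hRo hR j N c hc => ?_⟩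
  have hcircle : ∀ z, eLpNorm (fun t => laurentSum R (truncate j N c) (rotCoord j t z)) p
      haarAddCircle ≤ C * eLpNorm (fun t => laurentSum R c (rotCoord j t z)) p haarAddCircle := by
    intro z
    by_cases hz : z ∈ R
    -- On the circle through `z` the sum is a trigonometric series with frequencies `α j`, and
    -- truncation is its partial sum.
    · simp_rw [NormallyConvergent.laurentSum_rotCoord hR _ j hz]
      refine le_trans (le_of_eq ?_) (h (fun α => c α * laurentMonomial α z) (fun α => α j) N
        (hc.summable hz))
      congr 1
      ext t
      refine tsum_congr fun α => ?_
      unfold truncate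
      split_ifs <;> simp
    · simp_rw [NormallyConvergent.laurentSum_rotCoord_of_notMem hR _ j hz]
      simp
  refine ⟨hcircle, ?_⟩
  rw [← ENNReal.rpow_le_rpow_iff hq, ENNReal.mul_rpow_of_nonneg _ _ hq.le,
    eLpNorm_rpow_eq_lintegral_rotCoord j hp0 hp.ne ((hc.truncate j N).measurable_laurentSum hRo),
    eLpNorm_rpow_eq_lintegral_rotCoord j hp0 hp.ne (hc.measurable_laurentSum hRo),
    ← lintegral_const_mul' _ _ (ENNReal.rpow_ne_top_of_nonneg hq.le hC)]
  refine lintegral_mono fun z => ?_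
  rw [← ENNReal.mul_rpow_of_nonneg _ _ hq.le]
  exact ENNReal.rpow_le_rpow (hcircle z) hq.le

/-- The discarded coefficients, those with `|α_j| > N`, with opposite sign. -/
noncomputable def truncateError (j : Fin n) (N : ℕ) (c : (Fin n → ℤ) → ℂ) (α : Fin n → ℤ) : ℂ :=
  truncate j N c α - c α

theorem norm_truncateError_le (j : Fin n) (N : ℕ) (c : (Fin n → ℤ) → ℂ) (α : Fin n → ℤ) :
    ‖truncateError j N c α‖ ≤ ‖c α‖ := by
  unfold truncateError truncate
  split_ifs <;> simp

/-- Dominated convergence in `z` for the p-th powers of the circle norms. The uniform circle bound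
gives the majorant, so no density argument on the domain is needed. -/
theorem tendsto_eLpNorm_truncateError {p : ℝ≥0∞} (hp1 : 1 < p) (hp : p < ∞)
    {R : Set (Fin n → ℂ)} (hRo : IsOpen R) (hR : IsReinhardt R) (j : Fin n)
    {c : (Fin n → ℤ) → ℂ} (hc : NormallyConvergent R c)
    (hfin : eLpNorm (laurentSum R c) p volume ≠ ∞) :
    Tendsto (fun N => eLpNorm (laurentSum R (truncateError j N c)) p volume) atTop (𝓝 0) := by
  obtain ⟨C, hC, h⟩ := exists_eLpNorm_truncate_le hp1 hp
  have hp0 : p ≠ 0 := (zero_lt_one.trans hp1).ne'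
  have hq : 0 < p.toReal := ENNReal.toReal_pos hp0 hp.ne
  have he : ∀ N, NormallyConvergent R (truncateError j N c) := fun N =>
    hc.mono (norm_truncateError_le j N c)
  have hsplit : ∀ N, laurentSum R (truncate j N c) =
      laurentSum R (truncateError j N c) + laurentSum R c := by
    intro N
    rw [← (he N).laurentSum_add hc]
    congr 1
    ext α
    simp [truncateError]
  have hpow : Tendsto (fun N => eLpNorm (laurentSum R (truncateError j N c)) p volume ^ p.toReal)
      atTop (𝓝 0) := by
    simp_rw [fun N => eLpNorm_rpow_eq_lintegral_rotCoord j hp0 hp.ne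
      ((he N).measurable_laurentSum hRo)]
    have hbound := eLpNorm_rpow_eq_lintegral_rotCoord j hp0 hp.ne (hc.measurable_laurentSum hRo)
    have hDC := tendsto_lintegral_of_dominated_convergence (μ := (volume : Measure (Fin n → ℂ)))
      (F := fun N z => eLpNorm (fun t => laurentSum R (truncateError j N c) (rotCoord j t z)) p
        haarAddCircle ^ p.toReal) (f := fun _ => 0)
      (fun z => (C + 1) ^ p.toReal *
        eLpNorm (fun t => laurentSum R c (rotCoord j t z)) p haarAddCircle ^ p.toReal)
      (fun N => measurable_eLpNorm_rotCoord j hp0 hp.ne ((he N).measurable_laurentSum hRo))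
      (fun N => Eventually.of_forall fun z => ?_) ?_ (Eventually.of_forall fun z => ?_)
    · simpa using hDC
    · simp only
      rw [← ENNReal.mul_rpow_of_nonneg _ _ hq.le]
      refine ENNReal.rpow_le_rpow ?_ hq.le
      have h1 : (fun t => laurentSum R (truncateError j N c) (rotCoord j t z)) =
          (fun t => laurentSum R (truncate j N c) (rotCoord j t z)) -
          fun t => laurentSum R c (rotCoord j t z) := by
        ext t
        simp [hsplit]
      rw [h1, add_mul, one_mul]
      exact (eLpNorm_sub_le ((hc.truncate j N).aestronglyMeasurable_rotCoord hRo j z)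
        (hc.aestronglyMeasurable_rotCoord hRo j z) hp1.le).trans
        (add_le_add ((h hRo hR j N hc).1 z) le_rfl)
    · rw [lintegral_const_mul' _ _ (ENNReal.rpow_ne_top_of_nonneg hq.le (by finiteness)), ← hbound]
      exact ENNReal.mul_ne_top (ENNReal.rpow_ne_top_of_nonneg hq.le (by finiteness))
        (ENNReal.rpow_ne_top_of_nonneg hq.le hfin)
    · by_cases hz : z ∈ R
      -- The sup norm of the error on the circle is at most the sum of absolute values of the
      -- discarded terms; each term is eventually retained, so this tends to zero.
      · have hnorm : Tendsto (fun N : ℕ =>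
            ∑' α, ‖truncateError j N c α * laurentMonomial α z‖) atTop (𝓝 0) := by
          have := tendsto_tsum_of_dominated_convergence (𝓕 := (atTop : Filter ℕ))
            (f := fun N α => ‖truncateError j N c α * laurentMonomial α z‖) (g := fun _ => 0)
            (bound := fun α => ‖c α * laurentMonomial α z‖) (hc.summable hz) (fun α => ?_)
            (Eventually.of_forall fun N α => ?_)
          · simpa using this
          · refine tendsto_const_nhds.congr' ?_
            filter_upwards [eventually_ge_atTop (α j).natAbs] with N hN
            have : |α j| ≤ (N : ℤ) := by
              rw [Int.abs_eq_natAbs]; exact_mod_cast hN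
            simp [truncateError, truncate, this]
          · rw [norm_norm, norm_mul, norm_mul]
            gcongr
            exact norm_truncateError_le j N c α
        have hle : ∀ N, eLpNorm (fun t => laurentSum R (truncateError j N c) (rotCoord j t z)) p
            haarAddCircle ≤
            ENNReal.ofReal (∑' α, ‖truncateError j N c α * laurentMonomial α z‖) := by
          intro N
          refine (eLpNorm_le_of_ae_bound (C := ∑' α, ‖truncateError j N c α * laurentMonomial α z‖)
            (Eventually.of_forall fun t => ?_)).trans (by simp)
          rw [NormallyConvergent.laurentSum_rotCoord hR _ j hz]
          have hn : ∀ α, ‖truncateError j N c α * laurentMonomial α z * fourier (α j) t‖ =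
              ‖truncateError j N c α * laurentMonomial α z‖ := by
            intro α
            rw [norm_mul, fourier_apply, Circle.norm_coe, mul_one]
          simp_rw [← hn]
          refine norm_tsum_le_tsum_norm ?_
          simp_rw [hn]
          exact (he N).summable hz
        have h0 : Tendsto (fun N => eLpNorm (fun t =>
            laurentSum R (truncateError j N c) (rotCoord j t z)) p haarAddCircle) atTop (𝓝 0) := by
          refine tendsto_of_tendsto_of_tendsto_of_le_of_le tendsto_const_nhds ?_
            (fun N => zero_le) hle
          have := (ENNReal.continuous_ofReal.tendsto 0).comp hnorm
          simpa [Function.comp_def] using this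
        have := ((ENNReal.continuous_rpow_const (y := p.toReal)).tendsto 0).comp h0
        simpa [Function.comp_def, ENNReal.zero_rpow_of_pos hq] using this
      · simp [NormallyConvergent.laurentSum_rotCoord_of_notMem hR _ j hz,
          ENNReal.zero_rpow_of_pos hq]
  have := ((ENNReal.continuous_rpow_const (y := p.toReal⁻¹)).tendsto 0).comp hpow
  simpa [Function.comp_def, ← ENNReal.rpow_mul, mul_inv_cancel₀ hq.ne',
    ENNReal.zero_rpow_of_pos (inv_pos.2 hq)] using this

/-! ### Truncation in several coordinates. -/

/-- The coefficients with `|α_j| ≤ N` for all `j ∈ s`. -/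
noncomputable def truncateOn (s : Finset (Fin n)) (N : ℕ) (c : (Fin n → ℤ) → ℂ)
    (α : Fin n → ℤ) : ℂ :=
  open Classical in if ∀ j ∈ s, |α j| ≤ (N : ℤ) then c α else 0

theorem truncateOn_insert (s : Finset (Fin n)) (j : Fin n) (N : ℕ) (c : (Fin n → ℤ) → ℂ) :
    truncateOn (insert j s) N c = truncate j N (truncateOn s N c) := by
  ext α
  simp only [truncateOn, truncate, Finset.forall_mem_insert]
  split_ifs <;> tauto

theorem norm_truncateOn_le (s : Finset (Fin n)) (N : ℕ) (c : (Fin n → ℤ) → ℂ) (α : Fin n → ℤ) :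
    ‖truncateOn s N c α‖ ≤ ‖c α‖ := by
  unfold truncateOn
  split_ifs <;> simp

theorem norm_truncateOn_sub_le (s : Finset (Fin n)) (N : ℕ) (c : (Fin n → ℤ) → ℂ)
    (α : Fin n → ℤ) : ‖truncateOn s N c α - c α‖ ≤ ‖c α‖ := by
  unfold truncateOn
  split_ifs <;> simp

theorem eLpNorm_truncateOn_ne_top {p : ℝ≥0∞} (hp1 : 1 < p) (hp : p < ∞)
    {R : Set (Fin n → ℂ)} (hRo : IsOpen R) (hR : IsReinhardt R)
    {c : (Fin n → ℤ) → ℂ} (hc : NormallyConvergent R c)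
    (hfin : eLpNorm (laurentSum R c) p volume ≠ ∞) (s : Finset (Fin n)) (N : ℕ) :
    eLpNorm (laurentSum R (truncateOn s N c)) p volume ≠ ∞ := by
  obtain ⟨C, hC, h⟩ := exists_eLpNorm_truncate_le hp1 hp
  induction s using Finset.induction_on with
  | empty =>
    have : truncateOn ∅ N c = c := by ext; simp [truncateOn]
    rwa [this]
  | insert j s _ ih =>
    rw [truncateOn_insert]
    exact ne_top_of_le_ne_top (ENNReal.mul_ne_top hC ih)
      (h hRo hR j N (hc.mono (norm_truncateOn_le s N c))).2

/-- With `T` denoting truncation, `T_j T_s - 1 = T_j (T_s - 1) + (T_j - 1)`. The first term is small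
by induction because `T_j` is bounded uniformly in `N`, the second by the one-coordinate case. -/
theorem tendsto_eLpNorm_truncateOn_sub {p : ℝ≥0∞} (hp1 : 1 < p) (hp : p < ∞)
    {R : Set (Fin n → ℂ)} (hRo : IsOpen R) (hR : IsReinhardt R)
    {c : (Fin n → ℤ) → ℂ} (hc : NormallyConvergent R c)
    (hfin : eLpNorm (laurentSum R c) p volume ≠ ∞) (s : Finset (Fin n)) :
    Tendsto (fun N => eLpNorm (laurentSum R fun α => truncateOn s N c α - c α) p volume)
      atTop (𝓝 0) := by
  obtain ⟨C, hC, h⟩ := exists_eLpNorm_truncate_le hp1 hp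
  induction s using Finset.induction_on with
  | empty => simp [truncateOn, laurentSum]
  | insert j s _ ih =>
    have hN : ∀ N, NormallyConvergent R fun α => truncateOn s N c α - c α := fun N =>
      hc.mono (norm_truncateOn_sub_le s N c)
    have he : ∀ N, NormallyConvergent R (truncateError j N c) := fun N =>
      hc.mono (norm_truncateError_le j N c)
    have hlim := (ENNReal.Tendsto.const_mul (a := C) ih (Or.inr hC)).add
      (tendsto_eLpNorm_truncateError hp1 hp hRo hR j hc hfin)
    rw [mul_zero, add_zero] at hlim
    refine tendsto_of_tendsto_of_tendsto_of_le_of_le tendsto_const_nhds hlim (fun N => zero_le)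
      fun N => ?_
    have h1 : (fun α => truncateOn (insert j s) N c α - c α) = fun α =>
        truncate j N (fun α => truncateOn s N c α - c α) α + truncateError j N c α := by
      ext α
      rw [truncateOn_insert]
      simp only [truncateError, truncate]
      split_ifs <;> ring
    simp only
    rw [h1, ((hN N).truncate j N).laurentSum_add (he N)]
    exact (eLpNorm_add_le (((hN N).truncate j N).measurable_laurentSum hRo).aestronglyMeasurable
      ((he N).measurable_laurentSum hRo).aestronglyMeasurable hp1.le).trans
      (add_le_add (h hRo hR j N (hN N)).2 le_rfl)

theorem laurentSum_truncateOn_univ {R : Set (Fin n → ℂ)} (a : (Fin n → ℤ) → ℂ) (N : ℕ)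
    {z : Fin n → ℂ} (hz : z ∈ R) :
    laurentSum R (truncateOn Finset.univ N a) z = squarePartialSum a N z := by
  rw [laurentSum, Set.indicator_of_mem hz, squarePartialSum, tsum_eq_sum (s := squareIndices n N)]
  · refine Finset.sum_congr rfl fun α hα => ?_
    rw [mem_squareIndices] at hα
    simp [truncateOn, hα]
  · intro α hα
    rw [mem_squareIndices] at hα
    simp [truncateOn, hα]

end ReinhardtLaurent

/-! ### Conclusion. -/

theorem mainTheorem1 {n : ℕ} (R : Set (Fin n → ℂ))
    (hR : ReinhardtLaurent.IsBoundedReinhardtDomain R)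
    (p : ℝ≥0∞) (hp1 : 1 < p) (hp : p < ∞)
    (f : (Fin n → ℂ) → ℂ) (hf : ReinhardtLaurent.MemBergman R p f) :
    ∃ a : (Fin n → ℤ) → ℂ,
      ReinhardtLaurent.IsLaurentExpansion R f a ∧
      (∀ b : (Fin n → ℤ) → ℂ, ReinhardtLaurent.IsLaurentExpansion R f b → b = a) ∧
      (∀ N : ℕ, ReinhardtLaurent.MemBergman R p (ReinhardtLaurent.squarePartialSum a N)) ∧
      Tendsto
        (fun N : ℕ =>
          eLpNorm (fun z => ReinhardtLaurent.squarePartialSum a N z - f z) p (volume.restrict R))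
        atTop (𝓝 0) := by
  open ReinhardtLaurent in
  obtain ⟨a, ha, huniq, hbound⟩ := exists_unique_laurentExpansion hR hf.holomorphic
  have hc : NormallyConvergent R a := ⟨ha.wellDefined, hbound⟩
  have hRm := hR.isOpen.measurableSet
  have hfsum : ∀ z ∈ R, laurentSum R a z = f z := by
    intro z hz
    rw [laurentSum, Set.indicator_of_mem hz]
    exact ((ha.hasSum {z} (by simpa using hz) isCompact_singleton).hasSum (by simp)).tsum_eq
  have hrestrict : ∀ (c : (Fin n → ℤ) → ℂ) (g : (Fin n → ℂ) → ℂ), (∀ z ∈ R, laurentSum R c z = g z) →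
      eLpNorm (laurentSum R c) p volume = eLpNorm g p (volume.restrict R) := by
    intro c g hg
    have h1 : laurentSum R c = R.indicator g := by
      ext z
      by_cases hz : z ∈ R
      · rw [hg z hz, Set.indicator_of_mem hz]
      · simp [laurentSum, hz]
    rw [h1, eLpNorm_indicator_eq_eLpNorm_restrict hRm]
  have hfin : eLpNorm (laurentSum R a) p volume ≠ ∞ := by
    rw [hrestrict a f hfsum]
    exact hf.memLp.eLpNorm_ne_top
  refine ⟨a, ha, huniq, fun N => ?_, ?_⟩
  · have hhol : DifferentiableOn ℂ (squarePartialSum a N) R := by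
      intro z hz
      refine DifferentiableAt.differentiableWithinAt ?_
      unfold squarePartialSum
      refine DifferentiableAt.fun_sum fun α _ => ?_
      by_cases h0 : a α = 0
      · simp [h0]
      · exact (differentiableAt_laurentMonomial α (ha.wellDefined α h0 z hz)).const_mul _
    refine ⟨hhol, hhol.continuousOn.aestronglyMeasurable hRm, ?_⟩
    rw [← hrestrict _ _ fun z hz => laurentSum_truncateOn_univ a N hz, lt_top_iff_ne_top]
    exact eLpNorm_truncateOn_ne_top hp1 hp hR.isOpen hR.isReinhardt hc hfin _ N
  · have h := tendsto_eLpNorm_truncateOn_sub hp1 hp hR.isOpen hR.isReinhardt hc hfin Finset.univ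
    refine h.congr fun N => hrestrict _ _ fun z hz => ?_
    rw [← laurentSum_truncateOn_univ a N hz, ← hfsum z hz]
    -- Adding back the full series turns the sum of the coefficient differences into the difference
    -- of the sums.
    have h1 := (hc.mono (norm_truncateOn_sub_le Finset.univ N a)).laurentSum_add hc
    have h2 := congrFun h1 z
    simp only [sub_add_cancel, Pi.add_apply] at h2
    rw [eq_sub_iff_add_eq]
    exact h2.symm
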